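/- Let $\{\psi(x)\}_{x\in\mathbb R}$ be complex random variables on a probability space, jointly measurable in $(x,\omega)$, such that: 1. for every $x$, almost surely $\overline{\psi(x)}=\psi(-x)$, and $\psi(0)=0$ almost surely; 2. any finite subset of $\{\Re\psi(x),\Im\psi(x)\}_{x>0}$ is jointly Gaussian (not necessarily centred, possibly degenerate); 3. for every integer $k\ge 0$ there are constants $C_k$ and $b_k\ge0$ with $\mathbb E[|\psi(x)|^k]\le C_k(1+|x|^{b_k})$ for all $x\in\mathbb R$; 4. $\mathbb E\big[\int_{\mathbb R}|\psi(x)|^2\,dx\big]<\infty$; 5. $B(x,y):=\mathrm{cov}\big(\psi(x),\overline{\psi(y)}\big)=\mathbb E\big[(\psi(x)-\mathbb E\psi(x))\,\overline{(\psi(y)-\mathbb E\psi(y))}\big]$ satisfies $\int_{\mathbb R^2}|B(x,y)|^2\,dx\,dy<\infty$. Put $\mu(x):=\mathbb E[\psi(x)]$. Let $A:\mathbb R^2\to\mathbb C$ be continuous with $\overline{A(x,y)}=A(y,x)=A(-x,-y)$ and $\int_{\mathbb R^2}|A(x,y)|^2\,dx\,dy<\infty$, and let $\lambda\in L^2(\mathbb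 R)$ satisfy $\overline{\lambda(x)}=\lambda(-x)$ for almost every $x$. Write $\langle f,g\rangle=\int_{\mathbb R}\overline{f}\,g$. Then almost surely $\psi\in L^2(\mathbb R)$ and the integrals in the exponent on the left-hand side below converge absolutely, $\mu\in L^2(\mathbb R)$, and the kernels $A,B$ define bounded operators $\mathsf Af(x)=\int A(x,y)f(y)\,dy$ and $\mathsf Bf(x)=\int B(x,y)f(y)\,dy$ on $L^2(\mathbb R)$ which are self-adjoint and Hilbert–Schmidt. Moreover $\mathsf{BA}$ is trace class, $\mathsf 1-\mathrm i\mathsf{BA}$ is invertible, the Fredholm determinant $\det(\mathsf 1-z\mathrm i\mathsf{BA})$ is well defined for all $z\in\mathbb C$, there is a holomorphic square root $s$ of $z\mapsto\det(\mathsf 1-z\mathrm i\mathsf{BA})$ on $\{\Re z>0\}$ with $s(z)\to1$ as $z\to0$, and, with $\sqrt{\det(\mathsf 1-\mathrm i\mathsf{BA})}:=s(1)\neq0$ for this determination, $$\mathbb E\Big[\exp\Big(\tfrac{\mathrm i}{2}\int_{\mathbb R^2}\overline{\psi(x)}A(x,y)\psi(y)\,dx\,dy+\mathrm i\int_{\mathbb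 R}\overline{\lambda(x)}\psi(x)\,dx\Big)\Big] =\frac{\exp\Big(\tfrac{\mathrm i}{2}\langle\mu,\mathsf A(\mathsf 1-\mathrm i\mathsf{BA})^{-1}\mu\rangle+\mathrm i\langle\lambda,(\mathsf 1-\mathrm i\mathsf{BA})^{-1}\mu\rangle-\tfrac12\langle\lambda,(\mathsf 1-\mathrm i\mathsf{BA})^{-1}\mathsf B\lambda\rangle\Big)}{\sqrt{\det(\mathsf 1-\mathrm i\mathsf{BA})}}.$$ -/

import Mathlib

open MeasureTheory ProbabilityTheory Filter Topology
open scoped ENNReal InnerProductSpace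

namespace GaussianFredholm

/-- The complex Hilbert space `L²(ℝ)` (Lebesgue measure), with
`⟪f, g⟫_ℂ = ∫ conj (f x) * g x`. -/
abbrev L2R : Type := Lp ℂ 2 (volume : Measure ℝ)

section Operators

variable {E : Type*} [NormedAddCommGroup E] [InnerProductSpace ℂ E] [CompleteSpace E]

/-- A bounded operator `T` is Hilbert–Schmidt if `∑ ‖T e‖² < ∞` over every orthonormal basis. -/
def IsHilbertSchmidt (T : E →L[ℂ] E) : Prop :=
  ∀ (w : Set E) (b : HilbertBasis w ℂ E), Summable fun i => ‖T (b i)‖ ^ 2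

/-- A bounded operator on a Hilbert space is trace class (nuclear) if it is of the form
`f ↦ ∑ ⟪xₙ, f⟫ yₙ` with `∑ ‖xₙ‖ ‖yₙ‖ < ∞`. -/
def IsTraceClass (T : E →L[ℂ] E) : Prop :=
  ∃ x y : ℕ → E, (Summable fun n => ‖x n‖ * ‖y n‖) ∧
    ∀ f : E, HasSum (fun n => ⟪x n, f⟫_ℂ • y n) (T f)

open Classical in
/-- The principal minor of the matrix `⟪bᵢ, T bⱼ⟫` of `T` on the finite index set `S`. -/
noncomputable def principalMinor {ι : Type*} (b : HilbertBasis ι ℂ E) (T : E →L[ℂ] E)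
    (S : Finset ι) : ℂ :=
  (Matrix.of fun i j : S => ⟪b i, T (b j)⟫_ℂ).det

/-- `d` is the Fredholm determinant `det (1 + T) = ∑ₖ Tr (Λᵏ T)`. The trace of `Λᵏ T` is written
in the orthonormal basis of `Λᵏ E` induced by an orthonormal basis `b` of `E`, where it is the sum
of all principal minors of size `k`; the resulting sum over all finite subsets is to converge
(absolutely) to `d` in every orthonormal basis. -/
def HasFredholmDet (T : E →L[ℂ] E) (d : ℂ) : Prop :=
  ∀ (w : Set E) (b : HilbertBasis w ℂ E), HasSum (fun S : Finset w => principalMinor b T S) d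

open Classical in
/-- The Fredholm determinant `det (1 + T)` (the default value `0` is used if it does not exist). -/
noncomputable def fredholmDet (T : E →L[ℂ] E) : ℂ :=
  if h : ∃ d, HasFredholmDet T d then h.choose else 0

end Operators

/-- `T` is the integral operator `(T f)(x) = ∫ K(x, y) f(y) dy` on `L²(ℝ)`, the integral being
absolutely convergent for almost every `x`. -/
def IsIntegralOperator (K : ℝ → ℝ → ℂ) (T : L2R →L[ℂ] L2R) : Prop :=
  ∀ f : L2R, ∀ᵐ x : ℝ, (Integrable fun y => K x y * f y) ∧ T f x = ∫ y, K x y * f y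

/-- `s` is the determination on the half-plane `Re z > 0` of the square root of `D` that
equals `1` at (the boundary point) `z = 0`. -/
def IsSqrtDetermination (D s : ℂ → ℂ) : Prop :=
  DifferentiableOn ℂ s {z | 0 < z.re} ∧
  (∀ z : ℂ, 0 < z.re → s z ^ 2 = D z) ∧
  Tendsto s (𝓝[{z | 0 < z.re}] 0) (𝓝 1)

section Probability

variable {Ω : Type*} [MeasurableSpace Ω]

/-- The (bilinear) covariance `E[(X - E X) (Y - E Y)]` of two complex random variables. -/
noncomputable def complexCov (P : Measure Ω) (X Y : Ω → ℂ) : ℂ :=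
  ∫ ω, (X ω - ∫ ω', X ω' ∂P) * (Y ω - ∫ ω', Y ω' ∂P) ∂P

/-- The mean function `μ(x) = E[ψ(x)]`. -/
noncomputable def meanFun (P : Measure Ω) (ψ : ℝ → Ω → ℂ) (x : ℝ) : ℂ :=
  ∫ ω, ψ x ω ∂P

/-- The covariance kernel `B(x, y) = cov (ψ(x), conj ψ(y))`. -/
noncomputable def covKernel (P : Measure Ω) (ψ : ℝ → Ω → ℂ) (x y : ℝ) : ℂ :=
  complexCov P (ψ x) (fun ω => starRingEnd ℂ (ψ y ω))

/-- The phase `½ ∫∫ conj ψ(x) A(x, y) ψ(y) dx dy + ∫ conj λ(x) ψ(x) dx` of a path `g = ψ(·, ω)`. -/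
noncomputable def phase (A : ℝ → ℝ → ℂ) (lam : L2R) (g : ℝ → ℂ) : ℂ :=
  1 / 2 * (∫ p : ℝ × ℝ, starRingEnd ℂ (g p.1) * A p.1 p.2 * g p.2)
    + ∫ x : ℝ, starRingEnd ℂ (lam x) * g x

end Probability

end GaussianFredholm

/-! Let `Ψ` be the centred path, viewed as a random vector in `L²(ℝ)`, let `G ⊆ L²(P)` be a closed
space of centred Gaussian variables containing every real scalar product `⟪f, Ψ⟫`, and let `C X =
E[X Ψ]` for `X ∈ G`. Then `C C*` is the covariance of `Ψ`, while `K = C* A C` is a compact symmetric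
operator on `G`. An orthonormal eigenbasis `eₙ` of `K`, with eigenvalues `aₙ` and `yₙ = C eₙ`,
diagonalizes everything at once: `Ψ = ∑ eₙ yₙ`, `B = ∑ yₙ ⊗ yₙ` and `⟪yₘ, A yₙ⟫ = aₙ δₘₙ`
(`exists_diagonal_expansion`, `exists_isJointDiagonalization`).

Probabilistic side: the `eₙ` are independent standard normal variables and the phase is `∑ (½ aₙ eₙ²
+ ⟪l, yₙ⟫ eₙ)`, so the expectation factors into one-dimensional integrals `(1 - i aₙ)^(-1/2) exp (-½
⟪l, yₙ⟫² / (1 - i aₙ))`. Passing from finite sums to `Ψ` is harmless, because the phase is real and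
its exponential depends continuously on the random vector in `L²(P)` (`tendsto_gaussian_products`).

Operator side: `BA = ∑ yₙ ⊗ A yₙ` is in general not normal, but biorthogonality of `A yₘ` and `yₙ`
yields its resolvent explicitly (`hasSum_sub`) and `det (1 - i z BA) = ∏ (1 - i z aₙ)`. As the
determinant is defined by principal minors in an arbitrary basis, this needs
`hasFredholmDet_of_hasSum`, which rests on Sylvester's identity and on domination by minors of Gram
matrices. The square root is the product of the principal roots of the factors.

Two reductions remain. The symmetry `conj f(x) = f(-x)` cuts out a closed real subspace, preserved
by `A` and containing the paths, `μ` and `λ`, on which the complex inner product is real; hence real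
Gaussian spaces suffice. Centring replaces `λ` by `l = λ + A μ`, and `exponent_identity` turns the
resulting exponent into the stated one. -/

namespace GaussianFredholm

/-! ### Determinant inequalities for positive semidefinite matrices. -/

section FiniteMatrices

open Matrix
open scoped ComplexOrder

variable {n m : Type*} [Fintype n] [DecidableEq n] [Fintype m] [DecidableEq m]

/-- The coefficient of `X ^ k` in `det (1 + X M)` is the sum of the principal minors of size `k`;
evaluate at `X = 1`. -/
theorem det_one_add_eq_sum_minors (M : Matrix n n ℂ) :
    (1 + M).det = ∑ S : Finset n,
      (M.submatrix (Subtype.val : S → n) (Subtype.val : S → n)).det := by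
  have h1 : (1 + M).det =
      (det (1 + (Polynomial.X : Polynomial ℂ) • M.map Polynomial.C)).eval 1 := by
    rw [← Polynomial.coe_evalRingHom, RingHom.map_det]
    congr 1
    ext i j
    simp [Matrix.one_apply, apply_ite]
  have h2 : (det (1 + (Polynomial.X : Polynomial ℂ) • M.map Polynomial.C)).natDegree <
      Fintype.card n + 1 := by
    rw [Nat.lt_succ_iff, add_comm]
    simpa using Polynomial.natDegree_det_X_add_C_le M (1 : Matrix n n ℂ)
  rw [h1, Polynomial.eval_eq_sum_range' h2]
  simp only [one_pow, mul_one, coeff_det_one_add_X_smul_eq_sum_minors]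
  rw [← Finset.sum_fiberwise_of_maps_to (s := (Finset.univ : Finset (Finset n)))
    (t := Finset.range (Fintype.card n + 1)) (g := Finset.card)
    (fun S _ => Finset.mem_range.2 (Nat.lt_succ_of_le (Finset.card_le_univ S)))]
  refine Finset.sum_congr rfl fun k _ => Finset.sum_congr ?_ fun S _ => rfl
  ext S
  simp [Finset.mem_powersetCard]

theorem one_le_det_one_add {M : Matrix n n ℂ} (hM : M.PosSemidef) : 1 ≤ (1 + M).det := by
  rw [det_one_add_eq_sum_minors,
    ← Finset.add_sum_erase _ _ (Finset.mem_univ (∅ : Finset n))]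
  have h : 0 ≤ ∑ S ∈ Finset.univ.erase (∅ : Finset n),
      (M.submatrix (Subtype.val : S → n) (Subtype.val : S → n)).det :=
    Finset.sum_nonneg fun S _ => (hM.submatrix _).det_nonneg
  have h1 : (M.submatrix (Subtype.val : (∅ : Finset n) → n) Subtype.val).det = 1 :=
    det_isEmpty
  rw [h1]
  exact le_add_of_nonneg_right h

/-- For invertible `M = Lᴴ L`, factor `M + R = Lᴴ (1 + L⁻ᴴ R L⁻¹) L` and use that the middle
determinant is at least `1`. -/
theorem det_le_det_add {M R : Matrix n n ℂ} (hM : M.PosSemidef) (hR : R.PosSemidef) :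
    M.det ≤ (M + R).det := by
  by_cases h0 : M.det = 0
  · rw [h0]
    exact (hM.add hR).det_nonneg
  obtain ⟨L, hL⟩ : ∃ L : Matrix n n ℂ, M = Lᴴ * L := by
    open scoped MatrixOrder in
    exact CStarAlgebra.nonneg_iff_eq_star_mul_self.mp hM.nonneg
  have hLdet : IsUnit L.det := by
    rw [isUnit_iff_ne_zero]
    intro h
    exact h0 (by rw [hL, det_mul, h, mul_zero])
  have hLdet' : IsUnit Lᴴ.det := by
    rw [det_conjTranspose]
    exact hLdet.star
  have hC : (L⁻¹ᴴ * R * L⁻¹).PosSemidef := hR.conjTranspose_mul_mul_same _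
  have hfac : M + R = Lᴴ * (1 + L⁻¹ᴴ * R * L⁻¹) * L := by
    rw [mul_add, add_mul, mul_one, ← hL]
    congr 1
    rw [conjTranspose_nonsing_inv]
    simp only [← mul_assoc]
    rw [mul_nonsing_inv _ hLdet', one_mul, mul_assoc, nonsing_inv_mul _ hLdet, mul_one]
  have hdet : (M + R).det = M.det * (1 + L⁻¹ᴴ * R * L⁻¹).det := by
    rw [hfac, hL, det_mul, det_mul, det_mul]
    ring
  rw [hdet]
  exact le_mul_of_one_le_right hM.det_nonneg (one_le_det_one_add hC)

/-- Cauchy–Schwarz for determinants. With `Q = V (Vᴴ V)⁻¹ Vᴴ` the orthogonal projection onto the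
range of `V`, one has `|det UV|² = det (U Q Uᴴ) det (Vᴴ V)`, and `U Q Uᴴ ≤ U Uᴴ`. If `Vᴴ V` is
singular, then `V`, hence `UV`, has a kernel. -/
theorem norm_det_mul_sq_le (U : Matrix n m ℂ) (V : Matrix m n ℂ) :
    ‖(U * V).det‖ ^ 2 ≤ ‖(U * Uᴴ).det‖ * ‖(Vᴴ * V).det‖ := by
  by_cases h0 : (Vᴴ * V).det = 0
  · obtain ⟨c, hc, hc'⟩ := exists_mulVec_eq_zero_iff.2 h0
    have hV : V *ᵥ c = 0 := by
      rwa [conjTranspose_mul_self_mulVec_eq_zero] at hc'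
    have : (U * V).det = 0 := by
      rw [← exists_mulVec_eq_zero_iff]
      exact ⟨c, hc, by rw [← mulVec_mulVec, hV, mulVec_zero]⟩
    rw [this, h0]
    simp
  set G := Vᴴ * V with hG
  have hGu : IsUnit G.det := isUnit_iff_ne_zero.2 h0
  have hGH : Gᴴ = G := by rw [hG, conjTranspose_mul, conjTranspose_conjTranspose]
  set Q := V * G⁻¹ * Vᴴ with hQ
  have hQQ : Q * Q = Q := by
    calc Q * Q = V * (G⁻¹ * (Vᴴ * V) * G⁻¹) * Vᴴ := by simp only [hQ, Matrix.mul_assoc]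
      _ = Q := by rw [← hG, nonsing_inv_mul _ hGu, Matrix.one_mul]
  have hQH : Qᴴ = Q := by
    rw [hQ, conjTranspose_mul, conjTranspose_mul, conjTranspose_conjTranspose,
      conjTranspose_nonsing_inv, hGH, Matrix.mul_assoc]
  have hQpos : (U * Q * Uᴴ).PosSemidef := by
    have := posSemidef_self_mul_conjTranspose (U * Q)
    rwa [conjTranspose_mul, hQH, ← Matrix.mul_assoc, Matrix.mul_assoc U Q Q, hQQ] at this
  have hRpos : (U * (1 - Q) * Uᴴ).PosSemidef := by
    have := posSemidef_self_mul_conjTranspose (U * (1 - Q))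
    have h2 : (1 - Q) * (1 - Q) = 1 - Q := by
      rw [Matrix.mul_sub, Matrix.sub_mul, Matrix.sub_mul, hQQ]
      simp
    rwa [conjTranspose_mul, conjTranspose_sub, hQH, conjTranspose_one, ← Matrix.mul_assoc,
      Matrix.mul_assoc U, h2] at this
  have hle := det_le_det_add hQpos hRpos
  have hsum : U * Q * Uᴴ + U * (1 - Q) * Uᴴ = U * Uᴴ := by
    rw [← Matrix.add_mul, ← Matrix.mul_add, add_sub_cancel, Matrix.mul_one]
  rw [hsum] at hle
  have hfac : U * Q * Uᴴ = (U * V) * G⁻¹ * (U * V)ᴴ := by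
    rw [hQ, conjTranspose_mul]
    simp only [Matrix.mul_assoc]
  have hdet : (U * Q * Uᴴ).det * G.det = (U * V).det * star (U * V).det := by
    have h1 : G⁻¹.det * G.det = 1 := by rw [← det_mul, nonsing_inv_mul _ hGu, det_one]
    rw [hfac, det_mul, det_mul, det_conjTranspose, mul_right_comm, mul_assoc (U * V).det, h1,
      mul_one]
  have hle' : ‖(U * Q * Uᴴ).det‖ ≤ ‖(U * Uᴴ).det‖ :=
    CStarAlgebra.norm_le_norm_of_nonneg_of_le hQpos.det_nonneg hle
  calc ‖(U * V).det‖ ^ 2 = ‖(U * Q * Uᴴ).det * G.det‖ := by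
        rw [hdet, norm_mul, norm_star, sq]
    _ ≤ _ := by
        rw [norm_mul]
        gcongr

/-- In terms of eigenvalues, `∏ (1 + λᵢ) ≤ exp (∑ λᵢ)`; the product formula is the characteristic
polynomial at `-1`. -/
theorem norm_det_one_add_le {M : Matrix n n ℂ} (hM : M.PosSemidef) :
    ‖(1 + M).det‖ ≤ Real.exp M.trace.re := by
  have hdet : (1 + M).det = ∏ i, ((1 + hM.isHermitian.eigenvalues i : ℝ) : ℂ) := by
    have h1 : M.charpoly.eval (-1) = (-1) ^ Fintype.card n * (1 + M).det := by
      rw [Matrix.eval_charpoly, ← det_neg]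
      congr 1
      rw [map_neg, map_one, neg_add, sub_eq_add_neg]
    have h2 : (1 + M).det = (-1) ^ Fintype.card n * M.charpoly.eval (-1) := by
      rw [h1, ← mul_assoc, ← mul_pow]
      simp
    rw [h2, hM.isHermitian.charpoly_eq, Polynomial.eval_prod, ← Finset.card_univ,
      ← Finset.prod_const, ← Finset.prod_mul_distrib]
    refine Finset.prod_congr rfl fun i _ => ?_
    simp
    ring
  have htr : M.trace.re = ∑ i, hM.isHermitian.eigenvalues i := by
    rw [hM.isHermitian.trace_eq_sum_eigenvalues, Complex.re_sum]
    simp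
  rw [hdet, norm_prod, htr, Real.exp_sum]
  refine Finset.prod_le_prod (fun _ _ => norm_nonneg _) fun i _ => ?_
  have h0 := hM.eigenvalues_nonneg i
  rw [Complex.norm_real, Real.norm_of_nonneg (by linarith), add_comm]
  exact Real.add_one_le_exp _

end FiniteMatrices

/-! ### Fredholm determinants of sums of rank one operators. -/

section FredholmDeterminant

open Matrix
open scoped ComplexOrder

open Classical in
/-- The principal minor of an infinite matrix on a finite index set. -/
noncomputable def minor {κ : Type*} (Z : κ → κ → ℂ) (S : Finset κ) : ℂ :=
  (Matrix.of fun i j : S => Z i j).det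

open Classical in
theorem det_one_add_eq_sum_minor {κ : Type*} (Z : κ → κ → ℂ) (F : Finset κ) :
    (1 + Matrix.of fun i j : F => Z i j).det = ∑ S ∈ F.powerset, minor Z S := by
  rw [det_one_add_eq_sum_minors]
  refine Finset.sum_bij' (fun S' _ => S'.map (Function.Embedding.subtype _))
    (fun S _ => S.subtype (· ∈ F)) ?_ ?_ ?_ ?_ ?_
  · intro S' _
    rw [Finset.mem_powerset]
    intro i hi
    simp only [Finset.mem_map, Function.Embedding.subtype_apply] at hi
    obtain ⟨a, _, rfl⟩ := hi
    exact a.2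
  · simp
  · intro S' _
    ext i
    simp
  · intro S hS
    rw [Finset.mem_powerset] at hS
    rw [Finset.subtype_map, Finset.filter_true_of_mem hS]
  · intro S' _
    let e : S' ≃ S'.map (Function.Embedding.subtype (· ∈ F)) := Equiv.ofBijective
      (fun i => ⟨i.1.1, Finset.mem_map.2 ⟨i.1, i.2, rfl⟩⟩)
      ⟨fun i j hij => Subtype.ext (Subtype.ext (by simpa using hij)), fun i => by
        obtain ⟨a, ha, hai⟩ := Finset.mem_map.1 i.2
        exact ⟨⟨a, ha⟩, Subtype.ext hai⟩⟩
    rw [minor, ← Matrix.det_submatrix_equiv_self e]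
    rfl

variable {E : Type*} [NormedAddCommGroup E] [InnerProductSpace ℂ E]
variable {κ ι : Type*}

/-- The coordinates of finitely many vectors in an orthonormal basis. -/
noncomputable def coordMatrix (b : HilbertBasis κ ℂ E) (y : ι → E) (S : Finset κ) (M : Finset ι) :
    Matrix S M ℂ :=
  Matrix.of fun i n => ⟪b i, y n⟫_ℂ

theorem coordMatrix_mul_conjTranspose_apply (b : HilbertBasis κ ℂ E) (x y : ι → E) (S : Finset κ)
    (M : Finset ι) (i j : S) :
    (coordMatrix b y S M * (coordMatrix b x S M)ᴴ) i j =
      ∑ n ∈ M, ⟪b i, y n⟫_ℂ * ⟪x n, b j⟫_ℂ := by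
  rw [Matrix.mul_apply, ← Finset.sum_coe_sort M]
  refine Finset.sum_congr rfl fun n _ => ?_
  rw [conjTranspose_apply, coordMatrix, coordMatrix, of_apply, of_apply]
  congr 1
  exact inner_conj_symm _ _

open Classical in
theorem det_coordMatrix_mul (b : HilbertBasis κ ℂ E) (x y : ι → E) (S : Finset κ)
    (M : Finset ι) :
    (coordMatrix b y S M * (coordMatrix b x S M)ᴴ).det =
      minor (fun i j => ∑ n ∈ M, ⟪b i, y n⟫_ℂ * ⟪x n, b j⟫_ℂ) S := by
  rw [minor]
  congr 1
  ext i j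
  rw [coordMatrix_mul_conjTranspose_apply, of_apply]

open Classical in
-- Gram minors are nonnegative, so their sum over `s` is at most the sum over all subsets of the
-- union `F` of `s`, which is `det (1 + Z_F) ≤ exp (tr Z_F)`. Bessel's inequality bounds the trace
-- independently of `M` and `s`.
theorem norm_sum_minor_gram_le (b : HilbertBasis κ ℂ E) {y : ι → E}
    (hy : Summable fun n => ‖y n‖ ^ 2) (M : Finset ι) (s : Finset (Finset κ)) :
    ∑ S ∈ s, ‖minor (fun i j => ∑ n ∈ M, ⟪b i, y n⟫_ℂ * ⟪y n, b j⟫_ℂ) S‖ ≤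
      Real.exp (∑' n, ‖y n‖ ^ 2) := by
  set Z : κ → κ → ℂ := fun i j => ∑ n ∈ M, ⟪b i, y n⟫_ℂ * ⟪y n, b j⟫_ℂ with hZ
  have hpos : ∀ F : Finset κ, (Matrix.of fun i j : F => Z i j).PosSemidef := by
    intro F
    have := posSemidef_self_mul_conjTranspose (coordMatrix b y F M)
    convert this using 1
    ext i j
    rw [coordMatrix_mul_conjTranspose_apply, of_apply]
  have hnn : ∀ S, 0 ≤ minor Z S := fun S => (hpos S).det_nonneg
  set F : Finset κ := s.biUnion id
  have hsF : s ⊆ F.powerset := by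
    intro S hS
    rw [Finset.mem_powerset]
    exact Finset.subset_biUnion_of_mem id hS
  have htr : (Matrix.of fun i j : F => Z i j).trace.re ≤ ∑' n, ‖y n‖ ^ 2 := by
    have h1 : (Matrix.of fun i j : F => Z i j).trace.re =
        ∑ n ∈ M, ∑ i ∈ F, ‖⟪b i, y n⟫_ℂ‖ ^ 2 := by
      rw [Matrix.trace, Complex.re_sum, Finset.sum_comm, ← Finset.sum_coe_sort F]
      refine Finset.sum_congr rfl fun i _ => ?_
      rw [diag_apply, of_apply, hZ, Complex.re_sum]
      refine Finset.sum_congr rfl fun n _ => ?_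
      rw [← inner_conj_symm (y n), Complex.mul_conj, Complex.ofReal_re, Complex.normSq_eq_norm_sq]
    rw [h1]
    refine le_trans (Finset.sum_le_sum fun n _ => ?_) (hy.sum_le_tsum M fun _ _ => by positivity)
    exact b.orthonormal.sum_inner_products_le (y n)
  calc ∑ S ∈ s, ‖minor Z S‖ ≤ ∑ S ∈ F.powerset, ‖minor Z S‖ :=
        Finset.sum_le_sum_of_subset_of_nonneg hsF fun _ _ _ => norm_nonneg _
    _ = ‖∑ S ∈ F.powerset, minor Z S‖ := by
        have h2 : ∀ S, minor Z S = ((‖minor Z S‖ : ℝ) : ℂ) := fun S =>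
          (Complex.eq_coe_norm_of_nonneg (hnn S))
        rw [Finset.sum_congr rfl fun S _ => h2 S, ← Complex.ofReal_sum, Complex.norm_real,
          Real.norm_of_nonneg (Finset.sum_nonneg fun _ _ => norm_nonneg _)]
    _ = ‖(1 + Matrix.of fun i j : F => Z i j).det‖ := by rw [det_one_add_eq_sum_minor]
    _ ≤ Real.exp (Matrix.of fun i j : F => Z i j).trace.re := norm_det_one_add_le (hpos F)
    _ ≤ _ := Real.exp_le_exp.2 htr

open Classical in
theorem minor_gram_mono (b : HilbertBasis κ ℂ E) (y : ι → E) (S : Finset κ) :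
    Monotone fun M : Finset ι => ‖minor (fun i j => ∑ n ∈ M, ⟪b i, y n⟫_ℂ * ⟪y n, b j⟫_ℂ) S‖ := by
  have hpos : ∀ M : Finset ι, (Matrix.of fun i j : S =>
      ∑ n ∈ M, ⟪b i, y n⟫_ℂ * ⟪y n, b j⟫_ℂ).PosSemidef := by
    intro M
    have := posSemidef_self_mul_conjTranspose (coordMatrix b y S M)
    convert this using 1
    ext i j
    rw [coordMatrix_mul_conjTranspose_apply, of_apply]
  intro M M' hMM
  refine CStarAlgebra.norm_le_norm_of_nonneg_of_le (hpos M).det_nonneg ?_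
  have h := det_le_det_add (hpos M) (hpos (M' \ M))
  have hadd : (Matrix.of fun i j : S => ∑ n ∈ M, ⟪b i, y n⟫_ℂ * ⟪y n, b j⟫_ℂ) +
      (Matrix.of fun i j : S => ∑ n ∈ M' \ M, ⟪b i, y n⟫_ℂ * ⟪y n, b j⟫_ℂ) =
      Matrix.of fun i j : S => ∑ n ∈ M', ⟪b i, y n⟫_ℂ * ⟪y n, b j⟫_ℂ := by
    ext i j
    rw [Matrix.add_apply, of_apply, of_apply, of_apply, add_comm, Finset.sum_sdiff hMM]
  rw [hadd] at h
  exact h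

/-- The bound is the supremum over `M`. By monotonicity in `M` it is a limit, so the uniform bound
on finite sums of minors survives and gives summability. -/
theorem exists_summable_minor_gram_bound (b : HilbertBasis κ ℂ E) {y : ι → E}
    (hy : Summable fun n => ‖y n‖ ^ 2) :
    ∃ β : Finset κ → ℝ, Summable β ∧ ∀ M S,
      ‖minor (fun i j => ∑ n ∈ M, ⟪b i, y n⟫_ℂ * ⟪y n, b j⟫_ℂ) S‖ ≤ β S := by
  set f : Finset ι → Finset κ → ℝ := fun M S =>
    ‖minor (fun i j => ∑ n ∈ M, ⟪b i, y n⟫_ℂ * ⟪y n, b j⟫_ℂ) S‖ with hf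
  have hbdd : ∀ S, BddAbove (Set.range fun M => f M S) := by
    intro S
    refine ⟨Real.exp (∑' n, ‖y n‖ ^ 2), ?_⟩
    rintro _ ⟨M, rfl⟩
    simpa using norm_sum_minor_gram_le b hy M {S}
  have hle : ∀ M S, f M S ≤ ⨆ M, f M S := fun M S => le_ciSup (hbdd S) M
  refine ⟨fun S => ⨆ M, f M S, ?_, hle⟩
  refine summable_of_sum_le (c := Real.exp (∑' n, ‖y n‖ ^ 2))
    (fun S => (norm_nonneg _).trans (hle ∅ S)) fun s => ?_
  have ht : Tendsto (fun M => ∑ S ∈ s, f M S) atTop (𝓝 (∑ S ∈ s, ⨆ M, f M S)) :=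
    tendsto_finsetSum s fun S _ => tendsto_atTop_ciSup (minor_gram_mono b y S) (hbdd S)
  exact le_of_tendsto' ht fun M => norm_sum_minor_gram_le b hy M s

/-- Cauchy–Schwarz for determinants, followed by the inequality of arithmetic and geometric means.
-/
theorem norm_minor_le (b : HilbertBasis κ ℂ E) (x y : ι → E) (M : Finset ι) (S : Finset κ) :
    ‖minor (fun i j => ∑ n ∈ M, ⟪b i, y n⟫_ℂ * ⟪x n, b j⟫_ℂ) S‖ ≤
      (‖minor (fun i j => ∑ n ∈ M, ⟪b i, y n⟫_ℂ * ⟪y n, b j⟫_ℂ) S‖ +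
        ‖minor (fun i j => ∑ n ∈ M, ⟪b i, x n⟫_ℂ * ⟪x n, b j⟫_ℂ) S‖) / 2 := by
  classical
  have h := norm_det_mul_sq_le (coordMatrix b y S M) (coordMatrix b x S M)ᴴ
  rw [conjTranspose_conjTranspose, det_coordMatrix_mul, det_coordMatrix_mul,
    det_coordMatrix_mul] at h
  refine abs_le_of_sq_le_sq' (h.trans ?_) (by positivity) |>.2
  nlinarith [sq_nonneg (‖minor (fun i j => ∑ n ∈ M, ⟪b i, y n⟫_ℂ * ⟪y n, b j⟫_ℂ) S‖ -
        ‖minor (fun i j => ∑ n ∈ M, ⟪b i, x n⟫_ℂ * ⟪x n, b j⟫_ℂ) S‖)]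

theorem tendsto_minor {α : Type*} {l : Filter α} {Z : α → κ → κ → ℂ} {Z₀ : κ → κ → ℂ}
    (h : ∀ i j, Tendsto (fun a => Z a i j) l (𝓝 (Z₀ i j))) (S : Finset κ) :
    Tendsto (fun a => minor (Z a) S) l (𝓝 (minor Z₀ S)) := by
  classical
  refine ((continuous_id.matrix_det).tendsto _).comp ?_
  refine tendsto_pi_nhds.2 fun i => tendsto_pi_nhds.2 fun j => ?_
  exact h i j

open Classical in
/-- The Fredholm determinant of a sum `∑ yₙ ⊗ xₙ` of rank one operators with square summable
`xₙ` and `yₙ` is the limit of the determinants of the matrices `1 + ⟪xₘ, yₙ⟫`. -/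
theorem hasFredholmDet_of_hasSum [CompleteSpace E] {x y : ι → E}
    (hx : Summable fun n => ‖x n‖ ^ 2) (hy : Summable fun n => ‖y n‖ ^ 2) {T : E →L[ℂ] E}
    (hT : ∀ f, HasSum (fun n => ⟪x n, f⟫_ℂ • y n) (T f)) {d : ℂ}
    (hd : Tendsto (fun M : Finset ι => (1 + Matrix.of fun m n : M => ⟪x m, y n⟫_ℂ).det)
      atTop (𝓝 d)) : HasFredholmDet T d := by
  intro w b
  obtain ⟨βy, hβy, hby⟩ := exists_summable_minor_gram_bound b hy
  obtain ⟨βx, hβx, hbx⟩ := exists_summable_minor_gram_bound b hx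
  set g : Finset ι → Finset w → ℂ := fun M S =>
    minor (fun i j => ∑ n ∈ M, ⟪b i, y n⟫_ℂ * ⟪x n, b j⟫_ℂ) S with hg
  have hβ : Summable fun S => (βy S + βx S) / 2 := (hβy.add hβx).div_const 2
  have hbound : ∀ M S, ‖g M S‖ ≤ (βy S + βx S) / 2 := fun M S =>
    (norm_minor_le b x y M S).trans (by have := hby M S; have := hbx M S; linarith)
  have hlim : ∀ S, Tendsto (fun M => g M S) atTop (𝓝 (principalMinor b T S)) := by
    intro S
    refine tendsto_minor (Z₀ := fun i j => ⟪b i, T (b j)⟫_ℂ) (fun i j => ?_) S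
    have h := (hT (b j)).mapL (innerSL ℂ (b i))
    simp only [innerSL_apply_apply, inner_smul_right] at h
    simpa only [mul_comm, HasSum, SummationFilter.unconditional_filter] using h
  have hsum : Summable fun S => principalMinor b T S :=
    hβ.of_norm_bounded fun S => le_of_tendsto' (hlim S).norm fun M => hbound M S
  -- Sylvester's identity `det (1 + Y X*) = det (1 + X* Y)` trades the growing set `F` of basis
  -- indices for the fixed index set `M`; Parseval then gives the limit of the entries.
  have hfin : ∀ M, ∑' S, g M S = (1 + Matrix.of fun m n : M => ⟪x m, y n⟫_ℂ).det := by
    intro M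
    have hs : HasSum (g M) (∑' S, g M S) :=
      (hβ.of_norm_bounded fun S => hbound M S).hasSum
    have h1 := hs.comp tendsto_finset_powerset_atTop_atTop
    refine tendsto_nhds_unique h1 ?_
    have h2 : ∀ F : Finset w, ∑ S ∈ F.powerset, g M S =
        (1 + (coordMatrix b x F M)ᴴ * coordMatrix b y F M).det := by
      intro F
      have hmat : coordMatrix b y F M * (coordMatrix b x F M)ᴴ =
          Matrix.of fun i j : F => ∑ n ∈ M, ⟪b i, y n⟫_ℂ * ⟪x n, b j⟫_ℂ := by
        ext i j
        rw [coordMatrix_mul_conjTranspose_apply, of_apply]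
      rw [← det_one_add_mul_comm, hmat, hg, ← det_one_add_eq_sum_minor]
      congr!
    simp only [Function.comp_def, h2]
    refine ((continuous_id.matrix_det).tendsto _).comp ?_
    refine Tendsto.add tendsto_const_nhds
      (tendsto_pi_nhds.2 fun m => tendsto_pi_nhds.2 fun n => ?_)
    have h3 := b.hasSum_inner_mul_inner (x m) (y n)
    have h4 : ∀ F : Finset w, ((coordMatrix b x F M)ᴴ * coordMatrix b y F M) m n =
        ∑ i ∈ F, ⟪x m, b i⟫_ℂ * ⟪b i, y n⟫_ℂ := by
      intro F
      rw [Matrix.mul_apply, ← Finset.sum_coe_sort F]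
      refine Finset.sum_congr rfl fun i _ => ?_
      rw [conjTranspose_apply, coordMatrix, coordMatrix, of_apply, of_apply]
      congr 1
      exact inner_conj_symm _ _
    exact h3.congr fun F => (h4 F).symm
  -- Dominated convergence over `S` exchanges the sum of minors with the limit in `M`.
  have htsum : ∑' S, principalMinor b T S = d := by
    refine tendsto_nhds_unique (tendsto_tsum_of_dominated_convergence hβ hlim
      (Eventually.of_forall hbound)) ?_
    simpa only [hfin] using hd
  exact htsum ▸ hsum.hasSum

theorem HasFredholmDet.unique [CompleteSpace E] {T : E →L[ℂ] E} {d d' : ℂ}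
    (h : HasFredholmDet T d) (h' : HasFredholmDet T d') : d = d' := by
  obtain ⟨w, b, -⟩ := exists_hilbertBasis ℂ E
  exact (h w b).unique (h' w b)

theorem HasFredholmDet.fredholmDet_eq [CompleteSpace E] {T : E →L[ℂ] E} {d : ℂ}
    (h : HasFredholmDet T d) : fredholmDet T = d := by
  have h' : ∃ d, HasFredholmDet T d := ⟨d, h⟩
  rw [fredholmDet, dif_pos h']
  exact h'.choose_spec.unique h

/-- If `T = ∑ yₙ ⊗ xₙ` and `⟪xₘ, yₙ⟫ = aₙ δₘₙ`, then `det (1 + t T) = ∏ (1 + t aₙ)`. -/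
theorem hasFredholmDet_smul_of_biorthogonal [CompleteSpace E] {x y : ι → E}
    (hx : Summable fun n => ‖x n‖ ^ 2) (hy : Summable fun n => ‖y n‖ ^ 2) {T : E →L[ℂ] E}
    (hT : ∀ f, HasSum (fun n => ⟪x n, f⟫_ℂ • y n) (T f)) {a : ι → ℂ}
    (hdiag : ∀ n, ⟪x n, y n⟫_ℂ = a n) (hoff : ∀ m n, m ≠ n → ⟪x m, y n⟫_ℂ = 0)
    (ha : Summable a) (t : ℂ) :
    HasFredholmDet (t • T) (∏' n, (1 + t * a n)) := by
  classical
  have hty : Summable fun n => ‖t • y n‖ ^ 2 := by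
    simpa only [norm_smul, mul_pow] using hy.mul_left (‖t‖ ^ 2)
  refine hasFredholmDet_of_hasSum hx hty (fun f => ?_) ?_
  · simpa only [_root_.smul_apply, smul_comm t] using (hT f).const_smul t
  have hm : Multipliable fun n => 1 + t * a n :=
    Complex.multipliable_one_add_of_summable (ha.mul_left t)
  refine hm.hasProd.congr fun M => ?_
  have : (1 + Matrix.of fun m n : M => ⟪x m, t • y n⟫_ℂ) =
      Matrix.diagonal fun n : M => 1 + t * a n := by
    ext m n
    by_cases hmn : m = n
    · subst hmn
      simp [hdiag]
    · have : (m : ι) ≠ n := fun h => hmn (Subtype.ext h)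
      simp [hoff _ _ this, Matrix.one_apply_ne hmn,
        Matrix.diagonal_apply_ne _ hmn]
  rw [this, det_diagonal, Finset.prod_coe_sort M fun n => 1 + t * a n]

end FredholmDeterminant

/-! ### The holomorphic square root of the determinant. -/

section SquareRoot

/-- Factor `u - 1 = (√u - 1)(√u + 1)`; the principal root has nonnegative real part, so the second
factor has norm at least `1`. -/
theorem norm_cpow_inv_two_sub_one_le (u : ℂ) : ‖u ^ (2⁻¹ : ℂ) - 1‖ ≤ ‖u - 1‖ := by
  have hsq : (u ^ (2⁻¹ : ℂ)) ^ 2 = u := by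
    rw [← Complex.cpow_ofNat_mul]; simp
  have h1 : u - 1 = (u ^ (2⁻¹ : ℂ) - 1) * (u ^ (2⁻¹ : ℂ) + 1) := by
    linear_combination -hsq
  have h2 : 1 ≤ ‖u ^ (2⁻¹ : ℂ) + 1‖ := by
    refine le_trans ?_ (Complex.re_le_norm _)
    rw [Complex.add_re, Complex.one_re, Complex.cpow_inv_two_re]
    linarith [Real.sqrt_nonneg ((‖u‖ + u.re) / 2)]
  rw [h1, norm_mul]
  exact le_mul_of_one_le_right (norm_nonneg _) h2

variable {ι : Type*} (a : ι → ℝ)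

/-- The product of the principal square roots of the factors `1 - i z aₙ`. -/
noncomputable def sqrtDet (z : ℂ) : ℂ :=
  ∏' n, (1 + ((1 + -(z * Complex.I) * a n) ^ (2⁻¹ : ℂ) - 1))

variable {a}

theorem norm_sqrt_factor_sub_one_le (z : ℂ) (n : ι) :
    ‖(1 + -(z * Complex.I) * a n) ^ (2⁻¹ : ℂ) - 1‖ ≤ ‖z‖ * |a n| := by
  refine (norm_cpow_inv_two_sub_one_le _).trans (le_of_eq ?_)
  rw [add_sub_cancel_left, norm_mul, norm_neg, norm_mul, Complex.norm_I, mul_one,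
    Complex.norm_real, Real.norm_eq_abs]

theorem hasProd_sqrtDet (ha : Summable a) (z : ℂ) :
    HasProd (fun n => (1 + -(z * Complex.I) * a n) ^ (2⁻¹ : ℂ)) (sqrtDet a z) := by
  have h : Multipliable fun n => 1 + ((1 + -(z * Complex.I) * a n) ^ (2⁻¹ : ℂ) - 1) :=
    multipliable_one_add_of_summable
      ((ha.abs.mul_left ‖z‖).of_norm_bounded fun n => by
        rw [norm_norm]; exact norm_sqrt_factor_sub_one_le z n)
  have h2 := h.hasProd
  rw [← sqrtDet] at h2
  simpa only [add_sub_cancel] using h2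

/-- The imaginary part is `-x Re z`, which vanishes only for `x = 0`. This is where reality of the
`aₙ` enters. -/
theorem one_add_mem_slitPlane {z : ℂ} (hz : 0 < z.re) (x : ℝ) :
    1 + -(z * Complex.I) * x ∈ Complex.slitPlane := by
  rw [Complex.mem_slitPlane_iff]
  by_cases hx : x = 0
  · left; simp [hx]
  · right
    simp [hx, hz.ne']

theorem tprod_ne_zero (ha : Summable a) {z : ℂ} (hz : 0 < z.re) :
    ∏' n, (1 + -(z * Complex.I) * a n) ≠ 0 := by
  refine tprod_one_add_ne_zero_of_summable
    (fun n => Complex.slitPlane_ne_zero (one_add_mem_slitPlane hz _)) ?_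
  simp only [norm_mul, Complex.norm_real]
  exact ha.norm.mul_left _

theorem sqrtDet_sq (ha : Summable a) (z : ℂ) :
    sqrtDet a z ^ 2 = ∏' n, (1 + -(z * Complex.I) * a n) := by
  have h := (hasProd_sqrtDet ha z).pow 2
  rw [← h.tprod_eq]
  refine tprod_congr fun n => ?_
  rw [← Complex.cpow_ofNat_mul]; simp

theorem differentiableOn_sqrtDet (ha : Summable a) :
    DifferentiableOn ℂ (sqrtDet a) {z | 0 < z.re} := by
  intro z₀ hz₀
  -- The majorant `‖z‖ |aₙ|` is uniform only on bounded sets, so holomorphy is proved on a bounded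
  -- piece containing `z₀`.
  set U : Set ℂ := {z | 0 < z.re} ∩ Metric.ball 0 (‖z₀‖ + 1) with hU
  have hUo : IsOpen U := (isOpen_lt continuous_const Complex.continuous_re).inter Metric.isOpen_ball
  have hz₀U : z₀ ∈ U := ⟨hz₀, by simp⟩
  have hd : ∀ n, DifferentiableOn ℂ
      (fun z : ℂ => (1 + -(z * Complex.I) * a n) ^ (2⁻¹ : ℂ) - 1) U := by
    intro n z hz
    refine DifferentiableAt.differentiableWithinAt ?_
    have h1 : DifferentiableAt ℂ (fun z : ℂ => 1 + -(z * Complex.I) * a n) z := by fun_prop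
    exact (h1.cpow (differentiableAt_const _) (one_add_mem_slitPlane hz.1 _)).sub_const 1
  have hl := Summable.hasProdLocallyUniformlyOn_one_add (K := U)
    (f := fun n z => (1 + -(z * Complex.I) * a n) ^ (2⁻¹ : ℂ) - 1) hUo
    (ha.abs.mul_left (‖z₀‖ + 1)) (Eventually.of_forall fun n z hz => by
      refine (norm_sqrt_factor_sub_one_le z n).trans ?_
      have := hz.2
      rw [mem_ball_zero_iff] at this
      gcongr) (fun n => (hd n).continuousOn)
  have hl' := hasProdLocallyUniformlyOn_iff_tendstoLocallyUniformlyOn.1 hl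
  have hdiff : DifferentiableOn ℂ (sqrtDet a) U := by
    refine hl'.differentiableOn (Eventually.of_forall fun F => ?_) hUo
    exact DifferentiableOn.fun_finsetProd fun n _ => (hd n).const_add 1
  exact ((hdiff z₀ hz₀U).differentiableAt (hUo.mem_nhds hz₀U)).differentiableWithinAt

theorem tendsto_sqrtDet (ha : Summable a) :
    Tendsto (sqrtDet a) (𝓝[{z | 0 < z.re}] 0) (𝓝 1) := by
  have h : Tendsto (sqrtDet a) (𝓝 0) (𝓝 (∏' n : ι, ((1 : ℂ) + 0))) := by
    refine tendsto_tprod_one_add_of_dominated_convergence ha.abs (fun n => ?_) ?_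
    · have h1 : Tendsto (fun z : ℂ => ‖z‖ * |a n|) (𝓝 0) (𝓝 0) := by
        have : Continuous fun z : ℂ => ‖z‖ * |a n| := by fun_prop
        simpa using this.tendsto 0
      exact squeeze_zero_norm (fun z => norm_sqrt_factor_sub_one_le z n) h1
    · filter_upwards [Metric.ball_mem_nhds (0 : ℂ) one_pos] with z hz n
      refine (norm_sqrt_factor_sub_one_le z n).trans ?_
      rw [mem_ball_zero_iff] at hz
      exact mul_le_of_le_one_left (abs_nonneg _) hz.le
  simp only [add_zero, tprod_one] at h
  exact h.mono_left nhdsWithin_le_nhds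

theorem isSqrtDetermination_sqrtDet (ha : Summable a) :
    IsSqrtDetermination (fun z => ∏' n, (1 + -(z * Complex.I) * a n)) (sqrtDet a) :=
  ⟨differentiableOn_sqrtDet ha, fun z _ => sqrtDet_sq ha z, tendsto_sqrtDet ha⟩

theorem neBot_nhdsWithin_rightHalfPlane : (𝓝[{z : ℂ | 0 < z.re}] 0).NeBot := by
  rw [← mem_closure_iff_nhdsWithin_neBot, Complex.closure_setOfPred_lt_re]
  simp

/-- On a connected set where `D` has no zeros two continuous roots differ by a global sign, and the
limit `1` at the boundary point `0` fixes it. -/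
theorem IsSqrtDetermination.eq {D s s' : ℂ → ℂ} (hD : ∀ z : ℂ, 0 < z.re → D z ≠ 0)
    (h : IsSqrtDetermination D s) (h' : IsSqrtDetermination D s') {z : ℂ} (hz : 0 < z.re) :
    s z = s' z := by
  have hpre : IsPreconnected {z : ℂ | 0 < z.re} := (convex_halfSpace_re_gt 0).isPreconnected
  have hne := neBot_nhdsWithin_rightHalfPlane
  rcases hpre.eq_or_eq_neg_of_sq_eq h.1.continuousOn h'.1.continuousOn
    (fun z hz => by simp [h.2.1 z hz, h'.2.1 z hz])
    (fun {z} hz h0 => hD z hz (by rw [← h'.2.1 z hz, h0]; simp)) with h1 | h1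
  · exact h1 hz
  · exfalso
    have h2 : Tendsto s (𝓝[{z : ℂ | 0 < z.re}] 0) (𝓝 (-1)) :=
      h'.2.2.neg.congr' (by
        filter_upwards [self_mem_nhdsWithin] with z hz using (h1 hz).symm)
    have h3 := tendsto_nhds_unique h.2.2 h2
    norm_num at h3

end SquareRoot

/-! ### Trace class property, determinant and resolvent from a joint diagonalization. -/

section Resolvent

variable {E : Type*} [NormedAddCommGroup E] [InnerProductSpace ℂ E] [CompleteSpace E]
variable {ι : Type*}

omit [CompleteSpace E] in
-- The definition asks for sequences indexed by `ℕ`. Only countably many terms are nonzero, so they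
-- are encoded in `ℕ` and extended by zero.
theorem isTraceClass_of_hasSum {x y : ι → E} (hxy : Summable fun n => ‖x n‖ * ‖y n‖)
    {T : E →L[ℂ] E} (hT : ∀ f, HasSum (fun n => ⟪x n, f⟫_ℂ • y n) (T f)) : IsTraceClass T := by
  set s : Set ι := Function.support fun n => ‖x n‖ * ‖y n‖ with hs
  have hsc : s.Countable := hxy.countable_support
  have : Encodable s := hsc.toEncodable
  have hinj : Function.Injective (Encodable.encode : s → ℕ) := Encodable.encode_injective
  refine ⟨Function.extend (Encodable.encode : s → ℕ) (fun n => x n) 0,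
    Function.extend (Encodable.encode : s → ℕ) (fun n => y n) 0, ?_, fun f => ?_⟩
  · have h1 : (fun n => ‖Function.extend (Encodable.encode : s → ℕ) (fun n => x n) 0 n‖ *
        ‖Function.extend (Encodable.encode : s → ℕ) (fun n => y n) 0 n‖) =
        Function.extend (Encodable.encode : s → ℕ) (fun n => ‖x n‖ * ‖y n‖) 0 := by
      funext n
      by_cases hn : ∃ m : s, Encodable.encode m = n
      · obtain ⟨m, rfl⟩ := hn
        simp only [hinj.extend_apply]
      · simp [Function.extend_apply' _ _ _ hn]
    rw [h1, summable_extend_zero hinj]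
    exact hxy.subtype s
  · have h1 : (fun n => ⟪Function.extend (Encodable.encode : s → ℕ) (fun n => x n) 0 n, f⟫_ℂ •
        Function.extend (Encodable.encode : s → ℕ) (fun n => y n) 0 n) =
        Function.extend (Encodable.encode : s → ℕ) (fun n => ⟪x n, f⟫_ℂ • y n) 0 := by
      funext n
      by_cases hn : ∃ m : s, Encodable.encode m = n
      · obtain ⟨m, rfl⟩ := hn
        simp only [hinj.extend_apply]
      · simp [Function.extend_apply' _ _ _ hn]
    rw [h1, hasSum_extend_zero hinj]
    refine (hasSum_subtype_iff_of_support_subset (f := fun n => ⟪x n, f⟫_ℂ • y n)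
      fun n hn => ?_).2 (hT f)
    rw [Function.mem_support] at hn
    rw [hs, Function.mem_support]
    intro h0
    apply hn
    rcases mul_eq_zero.1 h0 with h | h <;> simp [norm_eq_zero.1 h]

theorem exists_hasSum_rankOne {x y : ι → E} (hxy : Summable fun n => ‖x n‖ * ‖y n‖) :
    ∃ T : E →L[ℂ] E, ∀ f, HasSum (fun n => ⟪x n, f⟫_ℂ • y n) (T f) := by
  have hs : Summable fun n => (innerSL ℂ (x n)).smulRight (y n) := by
    refine hxy.of_norm_bounded fun n => ?_
    rw [ContinuousLinearMap.norm_smulRight_apply, innerSL_apply_norm]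
  refine ⟨∑' n, (innerSL ℂ (x n)).smulRight (y n), fun f => ?_⟩
  have := hs.hasSum.mapL (ContinuousLinearMap.apply ℂ E f)
  simpa using this

variable {A B : E →L[ℂ] E} {y : ι → E} {a : ι → ℝ}

/-- `B = ∑ yₙ ⊗ yₙ` with square summable `yₙ`, and `⟪yₘ, A yₙ⟫ = aₙ δₘₙ`. -/
structure IsJointDiagonalization (A B : E →L[ℂ] E) (y : ι → E) (a : ι → ℝ) : Prop where
  selfAdjoint : IsSelfAdjoint A
  summable : Summable fun n => ‖y n‖ ^ 2
  hasSum : ∀ f, HasSum (fun n => ⟪y n, f⟫_ℂ • y n) (B f)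
  diag : ∀ n, ⟪y n, A (y n)⟫_ℂ = a n
  off : ∀ m n, m ≠ n → ⟪y m, A (y n)⟫_ℂ = 0

namespace IsJointDiagonalization

theorem inner_left (h : IsJointDiagonalization A B y a) (f g : E) :
    ⟪A f, g⟫_ℂ = ⟪f, A g⟫_ℂ :=
  h.selfAdjoint.isSymmetric f g

omit [CompleteSpace E] in
theorem norm_apply_le (n : ι) : ‖A (y n)‖ * ‖y n‖ ≤ ‖A‖ * ‖y n‖ ^ 2 := by
  rw [sq, ← mul_assoc]
  gcongr
  exact A.le_opNorm _

theorem summable_eigenvalues (h : IsJointDiagonalization A B y a) : Summable a := by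
  refine (h.summable.mul_left ‖A‖).of_norm_bounded fun n => ?_
  rw [← Complex.norm_real, ← h.diag, ← h.inner_left]
  exact (norm_inner_le_norm _ _).trans (norm_apply_le n)

theorem hasSum_mul (h : IsJointDiagonalization A B y a) (f : E) :
    HasSum (fun n => ⟪A (y n), f⟫_ℂ • y n) ((B * A) f) := by
  simpa only [h.inner_left, mul_apply_eq_comp] using h.hasSum (A f)

theorem summable_norm_mul (h : IsJointDiagonalization A B y a) :
    Summable fun n => ‖A (y n)‖ * ‖y n‖ :=
  (h.summable.mul_left ‖A‖).of_nonneg_of_le (fun _ => by positivity) norm_apply_le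

theorem isTraceClass (h : IsJointDiagonalization A B y a) : IsTraceClass (B * A) :=
  isTraceClass_of_hasSum h.summable_norm_mul h.hasSum_mul

theorem hasFredholmDet (h : IsJointDiagonalization A B y a) (t : ℂ) :
    HasFredholmDet (t • (B * A)) (∏' n, (1 + t * a n)) := by
  refine hasFredholmDet_smul_of_biorthogonal (x := fun n => A (y n)) ?_ h.summable
    h.hasSum_mul (a := fun n => (a n : ℂ)) (fun n => by rw [h.inner_left, h.diag])
    (fun m n hmn => by rw [h.inner_left, h.off m n hmn]) ?_ t
  · refine (h.summable.mul_left (‖A‖ ^ 2)).of_nonneg_of_le (fun _ => by positivity) fun n => ?_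
    rw [← mul_pow]
    gcongr
    exact A.le_opNorm _
  · exact_mod_cast h.summable_eigenvalues

/-- Biorthogonality leaves one term: every operator of this shape, in particular `BA`, has the `yₘ`
as eigenvectors. -/
theorem apply_of_hasSum (h : IsJointDiagonalization A B y a) {D : E →L[ℂ] E} {c : ι → ℂ}
    (hD : ∀ f, HasSum (fun n => (c n * ⟪A (y n), f⟫_ℂ) • y n) (D f)) (m : ι) :
    D (y m) = (c m * a m) • y m := by
  refine (hD (y m)).unique ?_
  have := hasSum_single (f := fun n => (c n * ⟪A (y n), y m⟫_ℂ) • y n) m (fun n hn => by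
    rw [h.inner_left, h.off n m hn, mul_zero, zero_smul])
  rwa [h.inner_left, h.diag] at this

theorem one_sub_ne_zero (x : ℝ) : 1 - Complex.I * x ≠ 0 := by
  intro h
  have := congrArg Complex.re h
  simp at this

/-- The inverse is `1 + D` with `D = ∑ cₙ yₙ ⊗ A yₙ` and `cₙ = i / (1 - i aₙ)`. Since `aₙ` is real,
`|cₙ| ≤ 1` and the series converges. The relation `cₙ = i + i cₙ aₙ` gives `D = i BA + i BA D`, and
`D` commutes with `BA`. The coefficients of `(1 + D) B` are `1 + cₙ aₙ = 1 / (1 - i aₙ)`. -/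
theorem hasSum_sub (h : IsJointDiagonalization A B y a) :
    ∃ R : E →L[ℂ] E, (1 - Complex.I • (B * A)) * R = 1 ∧ R * (1 - Complex.I • (B * A)) = 1 ∧
      ∀ f, HasSum (fun n => (⟪y n, f⟫_ℂ / (1 - Complex.I * a n)) • y n) ((R * B) f) := by
  set c : ι → ℂ := fun n => Complex.I / (1 - Complex.I * a n) with hc
  have hc1 : ∀ n, ‖c n‖ ≤ 1 := by
    intro n
    rw [hc, norm_div, Complex.norm_I]
    refine div_le_one_of_le₀ ?_ (norm_nonneg _)
    refine le_trans ?_ (Complex.re_le_norm _)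
    simp
  have hcn : ∀ n, c n = Complex.I + Complex.I * (c n * a n) := by
    intro n
    rw [hc]
    have := one_sub_ne_zero (a n)
    field_simp
    ring
  obtain ⟨D, hD⟩ := exists_hasSum_rankOne (x := fun n => A (y n)) (y := fun n => c n • y n)
    (h.summable_norm_mul.of_nonneg_of_le (fun _ => by positivity) fun n => by
      rw [norm_smul]
      gcongr
      exact mul_le_of_le_one_left (norm_nonneg _) (hc1 n))
  replace hD : ∀ f, HasSum (fun n => (c n * ⟪A (y n), f⟫_ℂ) • y n) (D f) := by
    intro f
    simpa only [smul_smul, mul_comm] using hD f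
  have hDy := h.apply_of_hasSum hD
  have hBy : ∀ m, (B * A) (y m) = (a m : ℂ) • y m := by
    intro m
    simpa using h.apply_of_hasSum (c := fun _ => 1) (D := B * A)
      (by simpa only [one_mul] using h.hasSum_mul) m
  have hBAD : ∀ f, HasSum (fun n => (c n * a n * ⟪A (y n), f⟫_ℂ) • y n) ((B * A) (D f)) := by
    intro f
    have := (hD f).mapL (B * A)
    simp only [map_smul, hBy, smul_smul] at this
    simpa only [mul_right_comm] using this
  have hDBA : ∀ f, HasSum (fun n => (c n * a n * ⟪A (y n), f⟫_ℂ) • y n) (D ((B * A) f)) := by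
    intro f
    have := (h.hasSum_mul f).mapL D
    simp only [map_smul, hDy, smul_smul] at this
    simpa only [mul_comm] using this
  have hkey : ∀ f, HasSum (fun n => (c n * ⟪A (y n), f⟫_ℂ) • y n)
      (Complex.I • (B * A) f + Complex.I • (B * A) (D f)) := by
    intro f
    have h0 := ((h.hasSum_mul f).const_smul Complex.I).add ((hBAD f).const_smul Complex.I)
    simp only [smul_smul, ← add_smul] at h0
    convert h0 using 3 with n
    nth_rewrite 1 [hcn n]
    ring
  have h1 : ∀ f, D f = Complex.I • (B * A) f + Complex.I • (B * A) (D f) := fun f =>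
    (hD f).unique (hkey f)
  have h2 : ∀ f, D ((B * A) f) = (B * A) (D f) := fun f => (hDBA f).unique (hBAD f)
  refine ⟨1 + D, ?_, ?_, fun f => ?_⟩
  · ext f
    have := h1 f
    simp only [mul_apply_eq_comp, _root_.sub_apply,
      _root_.add_apply, one_apply_eq_self,
      _root_.smul_apply, map_add] at this ⊢
    linear_combination (norm := module) this
  · ext f
    have := h1 f
    have h3 := h2 f
    simp only [mul_apply_eq_comp, _root_.sub_apply,
      _root_.add_apply, one_apply_eq_self,
      _root_.smul_apply, map_sub, map_smul] at this h3 ⊢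
    rw [h3]
    linear_combination (norm := module) this
  · have h3 := (h.hasSum f).add ((h.hasSum f).mapL D)
    simp only [map_smul, hDy, smul_smul, ← add_smul] at h3
    rw [mul_apply_eq_comp, _root_.add_apply, one_apply_eq_self]
    convert h3 using 3 with n
    · have := one_sub_ne_zero (a n)
      rw [hc]
      field_simp
      ring

theorem isUnit (h : IsJointDiagonalization A B y a) : IsUnit (1 - Complex.I • (B * A)) := by
  obtain ⟨R, h1, h2, -⟩ := h.hasSum_sub
  exact ⟨⟨_, R, h1, h2⟩, rfl⟩

theorem hasSum_inverse (h : IsJointDiagonalization A B y a) (f : E) :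
    HasSum (fun n => (⟪y n, f⟫_ℂ / (1 - Complex.I * a n)) • y n)
      (Ring.inverse (1 - Complex.I • (B * A)) (B f)) := by
  obtain ⟨R, h1, h2, h3⟩ := h.hasSum_sub
  have : Ring.inverse (1 - Complex.I • (B * A)) = R :=
    Ring.inverse_unit ⟨_, R, h1, h2⟩
  rw [this]
  exact h3 f

/-- This undoes the centring: the phase at the mean `m` plus the centred exponent with linear term
`lam + A m`. With `R` the resolvent, `i R B A m = R m - m` removes `B`, and the two cross terms
agree because the coefficients of `lam` and `A m` are real. -/
theorem exponent_identity (h : IsJointDiagonalization A B y a) (lam m : E)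
    (hlam : ∀ n, ⟪y n, lam⟫_ℂ = ⟪lam, y n⟫_ℂ) (hm : ∀ n, ⟪y n, A m⟫_ℂ = ⟪A m, y n⟫_ℂ) :
    Complex.I * (1 / 2 * ⟪m, A m⟫_ℂ + ⟪lam, m⟫_ℂ) -
      1 / 2 * ⟪lam + A m, Ring.inverse (1 - Complex.I • (B * A)) (B (lam + A m))⟫_ℂ =
    1 / 2 * Complex.I * ⟪m, A (Ring.inverse (1 - Complex.I • (B * A)) m)⟫_ℂ
      + Complex.I * ⟪lam, Ring.inverse (1 - Complex.I • (B * A)) m⟫_ℂ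
      - 1 / 2 * ⟪lam, Ring.inverse (1 - Complex.I • (B * A)) (B lam)⟫_ℂ := by
  set R := Ring.inverse (1 - Complex.I • (B * A)) with hR
  have hswap : ⟪A m, R (B lam)⟫_ℂ = ⟪lam, R (B (A m))⟫_ℂ := by
    have h1 := (h.hasSum_inverse lam).mapL (innerSL ℂ (A m))
    have h2 := (h.hasSum_inverse (A m)).mapL (innerSL ℂ lam)
    simp only [innerSL_apply_apply, inner_smul_right] at h1 h2
    refine h1.unique ?_
    convert h2 using 2 with n
    rw [hlam, hm]
    ring
  have hRm : Complex.I • R (B (A m)) = R m - m := by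
    have h1 : R * (1 - Complex.I • (B * A)) = 1 := Ring.inverse_mul_cancel _ h.isUnit
    have h2 := congrArg (fun T : E →L[ℂ] E => T m) h1
    simp only [mul_apply_eq_comp, _root_.sub_apply,
      one_apply_eq_self, _root_.smul_apply, map_sub, map_smul] at h2
    linear_combination (norm := module) -h2
  have hin : ∀ f : E, Complex.I * ⟪f, R (B (A m))⟫_ℂ = ⟪f, R m⟫_ℂ - ⟪f, m⟫_ℂ := by
    intro f
    rw [← inner_smul_right, hRm, inner_sub_right]
  have e1 := hin lam
  have e2 := hin (A m)
  rw [h.inner_left m (R m), h.inner_left m m] at e2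
  simp only [map_add, inner_add_left, inner_add_right, hswap]
  linear_combination (Complex.I) * e1 + (Complex.I / 2) * e2 -
    (⟪lam, R (B (A m))⟫_ℂ + ⟪A m, R (B (A m))⟫_ℂ / 2) * (Complex.I_sq)

end IsJointDiagonalization

end Resolvent

/-! ### Operators with square integrable kernels. -/

section IntegralOperators

theorem norm_toLp_sq {α F : Type*} [MeasurableSpace α] {μ : Measure α} [NormedAddCommGroup F]
    [InnerProductSpace ℝ F] {f : α → F} (hf : MemLp f 2 μ) :
    ‖hf.toLp f‖ ^ 2 = ∫ x, ‖f x‖ ^ 2 ∂μ := by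
  rw [← real_inner_self_eq_norm_sq, L2.inner_def]
  refine integral_congr_ae ?_
  filter_upwards [hf.coeFn_toLp] with x hx
  rw [hx, real_inner_self_eq_norm_sq]

theorem norm_Lp_sq {α F : Type*} [MeasurableSpace α] {μ : Measure α} [NormedAddCommGroup F]
    [InnerProductSpace ℝ F] (f : Lp F 2 μ) : ‖f‖ ^ 2 = ∫ x, ‖f x‖ ^ 2 ∂μ := by
  conv_lhs => rw [← Lp.toLp_coeFn f (Lp.memLp f)]
  exact norm_toLp_sq _

theorem inner_toLp_left {α : Type*} [MeasurableSpace α] {μ : Measure α} {k : α → ℂ}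
    (hk : MemLp k 2 μ) (f : Lp ℂ 2 μ) :
    ⟪hk.toLp k, f⟫_ℂ = ∫ x, starRingEnd ℂ (k x) * f x ∂μ := by
  rw [L2.inner_def]
  refine integral_congr_ae ?_
  filter_upwards [hk.coeFn_toLp] with x hx
  rw [hx, RCLike.inner_apply, mul_comm]

variable {K : ℝ → ℝ → ℂ}

theorem ae_memLp_conj_kernel (hKm : Measurable fun p : ℝ × ℝ => K p.1 p.2)
    (hK : Integrable fun p : ℝ × ℝ => ‖K p.1 p.2‖ ^ 2) :
    ∀ᵐ x : ℝ, MemLp (fun y => starRingEnd ℂ (K x y)) 2 (volume : Measure ℝ) := by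
  have h := (integrable_prod_iff (μ := volume) (ν := volume) hK.aestronglyMeasurable).1 hK
  filter_upwards [h.1] with x hx
  have hm : Measurable fun y => starRingEnd ℂ (K x y) :=
    Complex.continuous_conj.measurable.comp (hKm.comp measurable_prodMk_left)
  rw [memLp_two_iff_integrable_sq_norm hm.aestronglyMeasurable]
  simpa only [RCLike.norm_conj] using hx

theorem integral_kernel_eq_inner {x : ℝ}
    (hx : MemLp (fun y => starRingEnd ℂ (K x y)) 2 (volume : Measure ℝ)) (f : L2R) :
    ∫ y, K x y * f y = ⟪hx.toLp _, f⟫_ℂ := by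
  rw [inner_toLp_left]
  simp only [Complex.conj_conj]

theorem integrable_kernel_mul {x : ℝ}
    (hx : MemLp (fun y => starRingEnd ℂ (K x y)) 2 (volume : Measure ℝ)) (f : L2R) :
    Integrable fun y => K x y * f y := by
  have := L2.integrable_inner (𝕜 := ℂ) (hx.toLp _) f
  refine this.congr ?_
  filter_upwards [hx.coeFn_toLp] with y hy
  rw [hy, RCLike.inner_apply, Complex.conj_conj, mul_comm]

theorem aestronglyMeasurable_kernel_integral (hKm : Measurable fun p : ℝ × ℝ => K p.1 p.2)
    (f : L2R) : AEStronglyMeasurable (fun x => ∫ y, K x y * f y) (volume : Measure ℝ) := by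
  have h : StronglyMeasurable fun p : ℝ × ℝ => K p.1 p.2 * f p.2 :=
    hKm.stronglyMeasurable.mul ((Lp.stronglyMeasurable f).comp_measurable measurable_snd)
  exact h.integral_prod_right.aestronglyMeasurable

theorem sum_sq_kernel_integral_le {x : ℝ}
    (hx : MemLp (fun y => starRingEnd ℂ (K x y)) 2 (volume : Measure ℝ)) {κ : Type*}
    {e : κ → L2R} (he : Orthonormal ℂ e) (F : Finset κ) :
    ∑ i ∈ F, ‖∫ y, K x y * e i y‖ ^ 2 ≤ ∫ y, ‖K x y‖ ^ 2 := by
  have h := he.sum_inner_products_le (hx.toLp _) (s := F)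
  rw [norm_toLp_sq] at h
  simp only [RCLike.norm_conj] at h
  refine le_trans (le_of_eq (Finset.sum_congr rfl fun i _ => ?_)) h
  rw [integral_kernel_eq_inner hx, norm_inner_symm]

theorem norm_sq_kernel_integral_le {x : ℝ}
    (hx : MemLp (fun y => starRingEnd ℂ (K x y)) 2 (volume : Measure ℝ)) (f : L2R) :
    ‖∫ y, K x y * f y‖ ^ 2 ≤ ‖f‖ ^ 2 * ∫ y, ‖K x y‖ ^ 2 := by
  have h := norm_toLp_sq hx
  simp only [RCLike.norm_conj] at h
  rw [integral_kernel_eq_inner hx, ← h, ← mul_pow, mul_comm]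
  gcongr
  exact norm_inner_le_norm _ _

theorem memLp_kernel_integral (hKm : Measurable fun p : ℝ × ℝ => K p.1 p.2)
    (hK : Integrable fun p : ℝ × ℝ => ‖K p.1 p.2‖ ^ 2) (f : L2R) :
    MemLp (fun x => ∫ y, K x y * f y) 2 (volume : Measure ℝ) := by
  rw [memLp_two_iff_integrable_sq_norm (aestronglyMeasurable_kernel_integral hKm f)]
  refine (hK.integral_prod_left.const_mul (‖f‖ ^ 2)).mono'
    ((aestronglyMeasurable_kernel_integral hKm f).norm.pow 2) ?_
  filter_upwards [ae_memLp_conj_kernel hKm hK] with x hx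
  rw [Real.norm_of_nonneg (by positivity)]
  exact norm_sq_kernel_integral_le hx f

theorem exists_isIntegralOperator (hKm : Measurable fun p : ℝ × ℝ => K p.1 p.2)
    (hK : Integrable fun p : ℝ × ℝ => ‖K p.1 p.2‖ ^ 2) :
    ∃ T : L2R →L[ℂ] L2R, IsIntegralOperator K T := by
  have hae := ae_memLp_conj_kernel hKm hK
  let T₀ : L2R →ₗ[ℂ] L2R :=
    { toFun := fun f => (memLp_kernel_integral hKm hK f).toLp _
      map_add' := fun f g => by
        rw [← MemLp.toLp_add]
        refine MemLp.toLp_congr _ _ ?_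
        filter_upwards [hae] with x hx
        rw [Pi.add_apply, ← integral_add (integrable_kernel_mul hx f) (integrable_kernel_mul hx g)]
        refine integral_congr_ae ?_
        filter_upwards [Lp.coeFn_add f g] with y hy
        rw [hy, Pi.add_apply, mul_add]
      map_smul' := fun c f => by
        rw [RingHom.id_apply, ← MemLp.toLp_const_smul]
        refine MemLp.toLp_congr _ _ ?_
        filter_upwards [hae] with x hx
        rw [Pi.smul_apply, ← integral_smul]
        refine integral_congr_ae ?_
        filter_upwards [Lp.coeFn_smul c f] with y hy
        rw [hy, Pi.smul_apply, smul_eq_mul, smul_eq_mul, mul_left_comm] }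
  refine ⟨T₀.mkContinuous (√(∫ x : ℝ, ∫ y : ℝ, ‖K x y‖ ^ 2)) fun f => ?_, fun f => ?_⟩
  · refine le_of_sq_le_sq ?_ (by positivity)
    rw [mul_pow, Real.sq_sqrt (integral_nonneg fun x => integral_nonneg fun y => by positivity)]
    change ‖(memLp_kernel_integral hKm hK f).toLp _‖ ^ 2 ≤ _
    rw [norm_toLp_sq, mul_comm, ← integral_const_mul]
    refine integral_mono_ae ?_ (hK.integral_prod_left.const_mul (‖f‖ ^ 2)) ?_
    · exact (memLp_two_iff_integrable_sq_norm
        (aestronglyMeasurable_kernel_integral hKm f)).1 (memLp_kernel_integral hKm hK f)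
    · filter_upwards [hae] with x hx using norm_sq_kernel_integral_le hx f
  · have h := (memLp_kernel_integral hKm hK f).coeFn_toLp
    filter_upwards [hae, h] with x hx hx'
    exact ⟨integrable_kernel_mul hx f, hx'⟩

/-- Bessel's inequality for the row `conj K(x, ·)`, integrated over `x`, bounds all finite sums. -/
theorem IsIntegralOperator.isHilbertSchmidt (hKm : Measurable fun p : ℝ × ℝ => K p.1 p.2)
    (hK : Integrable fun p : ℝ × ℝ => ‖K p.1 p.2‖ ^ 2) {T : L2R →L[ℂ] L2R}
    (hT : IsIntegralOperator K T) : IsHilbertSchmidt T := by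
  intro w b
  refine summable_of_sum_le (c := ∫ x : ℝ, ∫ y : ℝ, ‖K x y‖ ^ 2) (fun _ => by positivity)
    fun F => ?_
  have hint : ∀ i, Integrable fun x => ‖T (b i) x‖ ^ 2 := fun i =>
    (memLp_two_iff_integrable_sq_norm (Lp.aestronglyMeasurable _)).1 (Lp.memLp (T (b i)))
  simp only [norm_Lp_sq]
  rw [← integral_finsetSum _ fun i _ => hint i]
  refine integral_mono_ae (integrable_finsetSum _ fun i _ => hint i) hK.integral_prod_left ?_
  have hall : ∀ᵐ x : ℝ, ∀ i ∈ F, T (b i) x = ∫ y, K x y * b i y :=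
    (Filter.eventually_all_finset F).2 fun i _ => (hT (b i)).mono fun x hx => hx.2
  filter_upwards [ae_memLp_conj_kernel hKm hK, hall] with x hx hx'
  refine le_trans (le_of_eq (Finset.sum_congr rfl fun i hi => ?_))
    (sum_sq_kernel_integral_le hx b.orthonormal F)
  rw [hx' i hi]

theorem integrable_sesquilinear (hKm : Measurable fun p : ℝ × ℝ => K p.1 p.2)
    (hK : Integrable fun p : ℝ × ℝ => ‖K p.1 p.2‖ ^ 2) (f g : L2R) :
    Integrable fun p : ℝ × ℝ => starRingEnd ℂ (g p.1) * K p.1 p.2 * f p.2 := by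
  have hf := (memLp_two_iff_integrable_sq_norm (Lp.aestronglyMeasurable f)).1 (Lp.memLp f)
  have hg := (memLp_two_iff_integrable_sq_norm (Lp.aestronglyMeasurable g)).1 (Lp.memLp g)
  have hm : StronglyMeasurable fun p : ℝ × ℝ => starRingEnd ℂ (g p.1) * K p.1 p.2 * f p.2 :=
    ((Complex.continuous_conj.comp_stronglyMeasurable
      ((Lp.stronglyMeasurable g).comp_measurable measurable_fst)).mul hKm.stronglyMeasurable).mul
      ((Lp.stronglyMeasurable f).comp_measurable measurable_snd)
  refine (hK.add (hg.mul_prod hf)).mono' hm.aestronglyMeasurable (Eventually.of_forall fun p => ?_)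
  rw [norm_mul, norm_mul, RCLike.norm_conj, Pi.add_apply]
  nlinarith [sq_nonneg (‖K p.1 p.2‖ - ‖g p.1‖ * ‖f p.2‖), norm_nonneg (K p.1 p.2),
    sq_nonneg (‖K p.1 p.2‖), sq_nonneg (‖g p.1‖ * ‖f p.2‖)]

theorem IsIntegralOperator.inner_eq (hKm : Measurable fun p : ℝ × ℝ => K p.1 p.2)
    (hK : Integrable fun p : ℝ × ℝ => ‖K p.1 p.2‖ ^ 2) {T : L2R →L[ℂ] L2R}
    (hT : IsIntegralOperator K T) (f g : L2R) :
    ⟪g, T f⟫_ℂ = ∫ p : ℝ × ℝ, starRingEnd ℂ (g p.1) * K p.1 p.2 * f p.2 := by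
  rw [Measure.volume_eq_prod, integral_prod _ (integrable_sesquilinear hKm hK f g), L2.inner_def]
  refine integral_congr_ae ?_
  filter_upwards [hT f] with x hx
  rw [hx.2, RCLike.inner_apply, mul_comm, ← integral_const_mul]
  simp only [mul_assoc]

theorem IsIntegralOperator.isSelfAdjoint (hKm : Measurable fun p : ℝ × ℝ => K p.1 p.2)
    (hK : Integrable fun p : ℝ × ℝ => ‖K p.1 p.2‖ ^ 2) {T : L2R →L[ℂ] L2R}
    (hT : IsIntegralOperator K T) (hsymm : ∀ x y, starRingEnd ℂ (K x y) = K y x) :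
    IsSelfAdjoint T := by
  rw [ContinuousLinearMap.isSelfAdjoint_iff_isSymmetric]
  intro f g
  change ⟪T f, g⟫_ℂ = ⟪f, T g⟫_ℂ
  rw [← inner_conj_symm, hT.inner_eq hKm hK, hT.inner_eq hKm hK, ← integral_conj,
    Measure.volume_eq_prod, ← integral_prod_swap]
  refine integral_congr_ae (Eventually.of_forall fun p => ?_)
  simp only [map_mul, Complex.conj_conj, Prod.fst_swap, Prod.snd_swap, hsymm]
  ring

end IntegralOperators

/-! ### Compactness and the spectral theorem. -/

section CompactOperators

theorem isCompactOperator_smulRight {𝕜 E F : Type*} [RCLike 𝕜] [NormedAddCommGroup E]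
    [NormedSpace 𝕜 E] [NormedAddCommGroup F] [NormedSpace 𝕜 F] (φ : E →L[𝕜] 𝕜) (v : F) :
    IsCompactOperator (φ.smulRight v) := by
  have h : IsCompactOperator (ContinuousLinearMap.toSpanSingleton 𝕜 v) :=
    isCompactOperator_of_locallyCompactSpace_rng _
  exact h.comp_clm φ

/-- `T` is the norm limit of the finite rank operators `∑ ⟪bᵢ, ·⟫ T bᵢ`: by Cauchy–Schwarz and
Bessel the norm of a block is at most `√(∑ ‖T bᵢ‖²)`. -/
theorem IsHilbertSchmidt.isCompactOperator {E : Type*} [NormedAddCommGroup E]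
    [InnerProductSpace ℂ E] [CompleteSpace E] {T : E →L[ℂ] E} (hT : IsHilbertSchmidt T) :
    IsCompactOperator T := by
  obtain ⟨w, b, -⟩ := exists_hilbertBasis ℂ E
  have hs := hT w b
  have hbound : ∀ F : Finset w, ‖∑ i ∈ F, (innerSL ℂ (b i)).smulRight (T (b i))‖ ≤
      √(∑ i ∈ F, ‖T (b i)‖ ^ 2) := by
    intro F
    refine ContinuousLinearMap.opNorm_le_bound _ (Real.sqrt_nonneg _) fun v => ?_
    rw [_root_.sum_apply]
    simp only [ContinuousLinearMap.smulRight_apply, innerSL_apply_apply]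
    calc ‖∑ i ∈ F, ⟪b i, v⟫_ℂ • T (b i)‖ ≤ ∑ i ∈ F, ‖T (b i)‖ * ‖⟪b i, v⟫_ℂ‖ :=
          norm_sum_le_of_le _ fun i _ => by rw [norm_smul, mul_comm]
      _ ≤ √(∑ i ∈ F, ‖T (b i)‖ ^ 2) * √(∑ i ∈ F, ‖⟪b i, v⟫_ℂ‖ ^ 2) :=
          Real.sum_mul_le_sqrt_mul_sqrt _ _ _
      _ ≤ √(∑ i ∈ F, ‖T (b i)‖ ^ 2) * ‖v‖ := by
          gcongr
          rw [Real.sqrt_le_left (norm_nonneg _)]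
          exact b.orthonormal.sum_inner_products_le v
  have hsum : Summable fun i => (innerSL ℂ (b i)).smulRight (T (b i)) := by
    rw [summable_iff_vanishing_norm]
    intro ε hε
    obtain ⟨s, hs'⟩ := summable_iff_vanishing_norm.1 hs (ε ^ 2) (by positivity)
    refine ⟨s, fun t ht => (hbound t).trans_lt ?_⟩
    have := hs' t ht
    rw [Real.norm_of_nonneg (Finset.sum_nonneg fun _ _ => by positivity)] at this
    rwa [Real.sqrt_lt' hε]
  have hlim : ∑' i, (innerSL ℂ (b i)).smulRight (T (b i)) = T := by
    ext v
    have h1 := hsum.hasSum.mapL (ContinuousLinearMap.apply ℂ E v)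
    have h2 := (b.hasSum_repr v).mapL T
    simp only [map_smul, b.repr_apply_apply] at h2
    simp only [ContinuousLinearMap.apply_apply, ContinuousLinearMap.smulRight_apply,
      innerSL_apply_apply] at h1
    exact h1.unique h2
  have h := hsum.hasSum
  rw [hlim] at h
  refine isCompactOperator_of_tendsto h (Eventually.of_forall fun F => ?_)
  have hmem : ∑ i ∈ F, (innerSL ℂ (b i)).smulRight (T (b i)) ∈
      compactOperator (RingHom.id ℂ) E E :=
    Submodule.sum_mem _ fun i _ => isCompactOperator_smulRight _ _
  exact hmem

theorem hilbertBasis_inner_eq_zero {E : Type*} [NormedAddCommGroup E] [InnerProductSpace ℝ E]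
    {V : Submodule ℝ E} {ι : Type*} (v : HilbertBasis ι ℝ V) {x : E}
    (hx : ∀ i, ⟪x, (v i : E)⟫_ℝ = 0) {u : E} (hu : u ∈ V) : ⟪x, u⟫_ℝ = 0 := by
  have h1 := (v.hasSum_repr ⟨u, hu⟩).mapL ((innerSL ℝ x).comp V.subtypeL)
  simp only [map_smul, ContinuousLinearMap.comp_apply, Submodule.subtypeL_apply,
    innerSL_apply_apply, hx, smul_zero] at h1
  exact h1.unique hasSum_zero

/-- Glue orthonormal bases of all eigenspaces, the kernel included. Symmetry makes the family
orthonormal, and the spectral theorem for compact operators makes it total. -/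
theorem exists_hilbertBasis_eigenvectors.{u} {E : Type u} [NormedAddCommGroup E]
    [InnerProductSpace ℝ E] [CompleteSpace E] {T : E →L[ℝ] E} (hc : IsCompactOperator T)
    (hT : T.IsSymmetric) :
    ∃ (ι : Type u) (b : HilbertBasis ι ℝ E) (a : ι → ℝ), ∀ n, T (b n) = a n • b n := by
  set V : ℝ → Submodule ℝ E := fun μ => Module.End.eigenspace (T : Module.End ℝ E) μ with hV
  have hmem : ∀ μ x, x ∈ V μ ↔ T x = μ • x := fun μ x => Module.End.mem_eigenspace_iff
  have hcomp : ∀ μ, CompleteSpace (V μ) := by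
    intro μ
    have : IsClosed (V μ : Set E) := by
      have h : (V μ : Set E) = {x | T x = μ • x} := Set.ext fun x => hmem μ x
      rw [h]
      exact isClosed_eq T.continuous (continuous_const_smul μ)
    exact this.completeSpace_coe
  choose w b hb using fun μ => exists_hilbertBasis ℝ (V μ)
  have hortho : OrthogonalFamily ℝ (fun μ => V μ) fun μ => (V μ).subtypeₗᵢ :=
    LinearMap.IsSymmetric.orthogonalFamily_eigenspaces hT
  have horth := hortho.orthonormal_sigma_orthonormal (fun μ => (b μ).orthonormal)
  have hbot : (Submodule.span ℝ (Set.range fun a : Σ μ, w μ =>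
      (V a.1).subtypeₗᵢ (b a.1 a.2)))ᗮ = ⊥ := by
    rw [eq_bot_iff]
    intro x hx
    have h0 : x ∈ (⨆ μ, V μ)ᗮ := by
      rw [← Submodule.iInf_orthogonal, Submodule.mem_iInf]
      intro μ
      rw [Submodule.mem_orthogonal']
      intro u hu
      refine hilbertBasis_inner_eq_zero (b μ) (fun i => ?_) hu
      exact (Submodule.mem_orthogonal' _ _).1 hx _ (Submodule.subset_span ⟨⟨μ, i⟩, rfl⟩)
    have h1 : (⨆ μ, V μ)ᗮ = ⊥ :=
      ContinuousLinearMap.orthogonalComplement_iSup_eigenspaces_eq_bot hc hT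
    rwa [h1] at h0
  refine ⟨Σ μ, w μ, HilbertBasis.mkOfOrthogonalEqBot horth hbot, fun n => n.1, fun n => ?_⟩
  rw [HilbertBasis.coe_mkOfOrthogonalEqBot]
  exact (hmem _ _).1 (b n.1 n.2).2

end CompactOperators

/-! ### One-dimensional Gaussian integrals and Gaussian subspaces of `L²(P)`. -/

section GaussianSpaces

theorem ofReal_mul_cpow {x : ℝ} (hx : 0 < x) {z : ℂ} (hz : z ≠ 0) (r : ℂ) :
    ((x : ℂ) * z) ^ r = (x : ℂ) ^ r * z ^ r := by
  have hx' : (x : ℂ) ≠ 0 := by exact_mod_cast hx.ne'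
  rw [Complex.cpow_def_of_ne_zero (mul_ne_zero hx' hz), Complex.cpow_def_of_ne_zero hx',
    Complex.cpow_def_of_ne_zero hz, Complex.log_ofReal_mul hx hz, ← Complex.exp_add,
    Complex.ofReal_log hx.le, add_mul]

/-- With the density absorbed, this is a Gaussian integral with leading coefficient `-(1 - i a) /
2`. The principal power may be split because `2π > 0` and `1 - i a` lies in the slit plane. The base
is written as the factor of `sqrtDet` at `z = 1`. -/
theorem integral_cexp_quadratic_gaussianReal (a l : ℝ) :
    ∫ x, Complex.exp (Complex.I * (1 / 2 * a * (x : ℂ) ^ 2 + l * x)) ∂gaussianReal 0 1 =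
      ((1 + -(1 * Complex.I) * a) ^ (2⁻¹ : ℂ))⁻¹ *
        Complex.exp (-(1 / 2) * ((l : ℂ) ^ 2 / (1 - Complex.I * a))) := by
  have hd : 1 - Complex.I * a ≠ 0 := IsJointDiagonalization.one_sub_ne_zero a
  have hre : (-(1 - Complex.I * a) / 2 : ℂ).re < 0 := by
    norm_num [Complex.div_re]
  have hpi : (0 : ℝ) < 2 * Real.pi := by positivity
  have h1 : ∀ x : ℝ, gaussianPDFReal 0 1 x •
      Complex.exp (Complex.I * (1 / 2 * a * (x : ℂ) ^ 2 + l * x)) =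
      ((√(2 * Real.pi))⁻¹ : ℝ) * Complex.exp (-(1 - Complex.I * a) / 2 * (x : ℂ) ^ 2 +
        Complex.I * l * x + 0) := by
    intro x
    rw [gaussianPDFReal_def, Complex.real_smul]
    push_cast
    rw [mul_assoc, ← Complex.exp_add]
    simp only [mul_one]
    congr 2
    ring
  rw [integral_gaussianReal_eq_integral_smul one_ne_zero]
  simp only [h1]
  rw [integral_const_mul, integral_cexp_quadratic hre, ← mul_assoc]
  have hbase : (1 + -(1 * Complex.I) * a : ℂ) = 1 - Complex.I * a := by ring
  have harg : (1 - Complex.I * a : ℂ).arg ≠ Real.pi := by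
    have := one_add_mem_slitPlane (z := 1) (by simp) a
    rw [hbase] at this
    exact Complex.mem_slitPlane_iff_arg.1 this |>.1
  have hpow : ((Real.pi : ℂ) / -(-(1 - Complex.I * a) / 2)) ^ (1 / 2 : ℂ) =
      (√(2 * Real.pi) : ℝ) * ((1 - Complex.I * a) ^ (2⁻¹ : ℂ))⁻¹ := by
    have : (Real.pi : ℂ) / -(-(1 - Complex.I * a) / 2) =
        ((2 * Real.pi : ℝ) : ℂ) * (1 - Complex.I * a)⁻¹ := by
      push_cast
      field_simp
    rw [this, ofReal_mul_cpow hpi (inv_ne_zero hd), Complex.inv_cpow _ _ harg, Real.sqrt_eq_rpow,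
      Complex.ofReal_cpow hpi.le, one_div]
    norm_num
  have hs : ((√(2 * Real.pi) : ℝ) : ℂ) ≠ 0 := by
    exact_mod_cast (Real.sqrt_pos.2 hpi).ne'
  rw [hpow, hbase, ← mul_assoc, Complex.ofReal_inv, inv_mul_cancel₀ hs, one_mul]
  congr 2
  have hI : (Complex.I * l) ^ 2 = -(l : ℂ) ^ 2 := by rw [mul_pow, Complex.I_sq]; ring
  rw [hI]
  field_simp
  ring

variable {Ω : Type*} [MeasurableSpace Ω] {P : Measure Ω} [IsProbabilityMeasure P]

/-- A linear space of centred Gaussian random variables. -/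
def IsGaussianSpace (P : Measure Ω) (G : Submodule ℝ (Lp ℝ 2 P)) : Prop :=
  ∀ X ∈ G, ∫ ω, Complex.exp (X ω * Complex.I) ∂P = Complex.exp (-((‖X‖ ^ 2 : ℝ) : ℂ) / 2)

variable {G : Submodule ℝ (Lp ℝ 2 P)}

/-- `|exp (i s) - exp (i t)| ≤ |s - t|`, and the `L¹` norm is at most the `L²` norm. This makes the
Gaussian property stable under `L²` limits. -/
theorem lipschitz_charFun :
    LipschitzWith 1 fun X : Lp ℝ 2 P => ∫ ω, Complex.exp (X ω * Complex.I) ∂P := by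
  refine LipschitzWith.of_dist_le_mul fun X Y => ?_
  have hint : ∀ X : Lp ℝ 2 P, Integrable (fun ω => Complex.exp (X ω * Complex.I)) P := by
    intro X
    refine Integrable.of_bound (C := 1) ?_ (Eventually.of_forall fun ω => ?_)
    · exact (Complex.continuous_exp.comp (Complex.continuous_ofReal.mul continuous_const)
        ).comp_aestronglyMeasurable (Lp.aestronglyMeasurable X)
    · rw [Complex.norm_exp_ofReal_mul_I]
  have hXY : Integrable (fun ω => ‖(X - Y : Lp ℝ 2 P) ω‖) P :=
    ((Lp.memLp (X - Y)).integrable one_le_two).norm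
  rw [dist_eq_norm, dist_eq_norm, ← integral_sub (hint X) (hint Y), NNReal.coe_one, one_mul]
  calc ‖∫ ω, (Complex.exp (X ω * Complex.I) - Complex.exp (Y ω * Complex.I)) ∂P‖
      ≤ ∫ ω, ‖(X - Y : Lp ℝ 2 P) ω‖ ∂P := by
        refine norm_integral_le_of_norm_le hXY ?_
        filter_upwards [Lp.coeFn_sub X Y] with ω hω
        rw [hω, Pi.sub_apply]
        have h1 : Complex.exp (X ω * Complex.I) - Complex.exp (Y ω * Complex.I) =
            Complex.exp (Y ω * Complex.I) * (Complex.exp (Complex.I * (X ω - Y ω : ℝ)) - 1) := by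
          rw [mul_sub, ← Complex.exp_add, mul_one]
          push_cast
          ring_nf
        rw [h1, norm_mul, Complex.norm_exp_ofReal_mul_I, one_mul]
        exact Real.norm_exp_I_mul_ofReal_sub_one_le
    _ ≤ ‖X - Y‖ := by
        refine abs_le_of_sq_le_sq' ?_ (norm_nonneg _) |>.2
        rw [norm_Lp_sq]
        have h2 := (Lp.memLp (X - Y)).norm
        have hv := variance_nonneg (fun ω => ‖(X - Y : Lp ℝ 2 P) ω‖) P
        rw [variance_eq_sub h2] at hv
        have h3 : ∫ ω, ‖(X - Y : Lp ℝ 2 P) ω‖ ^ 2 ∂P =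
          P[(fun ω => ‖(X - Y : Lp ℝ 2 P) ω‖) ^ 2] := rfl
        rw [h3]
        linarith

theorem IsGaussianSpace.topologicalClosure (hG : IsGaussianSpace P G) :
    IsGaussianSpace P G.topologicalClosure := by
  intro X hX
  have hclosed : IsClosed {X : Lp ℝ 2 P | ∫ ω, Complex.exp (X ω * Complex.I) ∂P =
      Complex.exp (-((‖X‖ ^ 2 : ℝ) : ℂ) / 2)} := by
    refine isClosed_eq lipschitz_charFun.continuous ?_
    fun_prop
  exact closure_minimal (fun Y hY => hG Y hY) hclosed hX

/-- The defining identity applied to all multiples `t • X` is the whole characteristic function. -/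
theorem IsGaussianSpace.map_eq (hG : IsGaussianSpace P G) {X : Lp ℝ 2 P} (hX : X ∈ G) :
    P.map X = gaussianReal 0 (‖X‖₊ ^ 2) := by
  have hm : AEMeasurable X P := (Lp.aestronglyMeasurable X).aemeasurable
  have := Measure.isProbabilityMeasure_map (μ := P) hm
  refine Measure.ext_of_charFun (funext fun t => ?_)
  rw [charFun_gaussianReal, charFun_apply_real, integral_map hm (by fun_prop)]
  have h := hG (t • X) (G.smul_mem t hX)
  have h1 : ∫ ω, Complex.exp ((t • X : Lp ℝ 2 P) ω * Complex.I) ∂P =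
      ∫ ω, Complex.exp (t * X ω * Complex.I) ∂P := by
    refine integral_congr_ae ?_
    filter_upwards [Lp.coeFn_smul t X] with ω hω
    rw [hω, Pi.smul_apply, smul_eq_mul, Complex.ofReal_mul]
  rw [← h1, h, norm_smul]
  congr 1
  push_cast
  rw [mul_pow, Real.norm_eq_abs, ← Complex.ofReal_pow, sq_abs]
  simp
  ring

theorem IsGaussianSpace.integral_eq_zero (hG : IsGaussianSpace P G) {X : Lp ℝ 2 P} (hX : X ∈ G) :
    ∫ ω, X ω ∂P = 0 := by
  have hm : AEMeasurable X P := (Lp.aestronglyMeasurable X).aemeasurable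
  have h := integral_map (f := fun x : ℝ => x) hm (by fun_prop)
  rw [hG.map_eq hX, integral_id_gaussianReal] at h
  exact h.symm

omit [IsProbabilityMeasure P] in
theorem coeFn_finset_sum_smul {ι : Type*} (F : Finset ι) (c : ι → ℝ) (e : ι → Lp ℝ 2 P) :
    ⇑(∑ n ∈ F, c n • e n) =ᵐ[P] fun ω => ∑ n ∈ F, c n * e n ω := by
  refine (Lp.coeFn_finsetSum F fun n => c n • e n).trans ?_
  have h : ∀ᵐ ω ∂P, ∀ n ∈ F, (c n • e n : Lp ℝ 2 P) ω = c n * e n ω :=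
    (Filter.eventually_all_finset F).2 fun n _ => Lp.coeFn_smul (c n) (e n)
  filter_upwards [h] with ω hω
  rw [Finset.sum_apply]
  exact Finset.sum_congr rfl hω

/-- All linear combinations stay in `G`, so the family is jointly Gaussian; orthogonality of centred
variables is vanishing covariance, hence independence. -/
theorem IsGaussianSpace.iIndepFun (hG : IsGaussianSpace P G) {ι : Type*} {e : ι → Lp ℝ 2 P}
    (he : Orthonormal ℝ e) (heG : ∀ n, e n ∈ G) (F : Finset ι) :
    iIndepFun (fun n : F => (e n : Ω → ℝ)) P := by
  classical
  have hm : ∀ n, AEMeasurable (e n) P := fun n => (Lp.aestronglyMeasurable _).aemeasurable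
  have hlaw : HasGaussianLaw (fun ω => fun n : F => e n ω) P := by
    refine ⟨isGaussian_of_isGaussian_map fun L => ?_⟩
    have hmeas : AEMeasurable (fun ω => fun n : F => e n ω) P :=
      aemeasurable_pi_lambda _ fun n => hm n
    rw [AEMeasurable.map_map_of_aemeasurable (by fun_prop) hmeas]
    set X : Lp ℝ 2 P := ∑ n : F, L (Pi.single n 1) • e n with hX
    have hXG : X ∈ G := Submodule.sum_mem _ fun n _ => G.smul_mem _ (heG n)
    have hae : (⇑L ∘ fun ω => fun n : F => e n ω) =ᵐ[P] X := by
      filter_upwards [coeFn_finset_sum_smul Finset.univ (fun n : F => L (Pi.single n 1))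
        (fun n : F => e n)] with ω hω
      rw [hX, hω, Function.comp_apply]
      conv_lhs => rw [pi_eq_sum_univ' (fun n : F => e n ω), map_sum]
      refine Finset.sum_congr rfl fun n _ => ?_
      rw [map_smul, smul_eq_mul, mul_comm]
    rw [Measure.map_congr hae, hG.map_eq hXG]
    infer_instance
  refine hlaw.iIndepFun_of_covariance_eq_zero fun i j hij => ?_
  rw [covariance_eq_sub (Lp.memLp _) (Lp.memLp _), hG.integral_eq_zero (heG i), zero_mul, sub_zero]
  have h : ⟪e i, e j⟫_ℝ = 0 := he.2 fun h => hij (Subtype.ext h)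
  rw [L2.inner_def] at h
  rw [← h]
  refine integral_congr_ae (Eventually.of_forall fun ω => ?_)
  simp [mul_comm]

theorem IsGaussianSpace.integral_cexp_quadratic (hG : IsGaussianSpace P G) {ι : Type*}
    {e : ι → Lp ℝ 2 P} (he : Orthonormal ℝ e) (heG : ∀ n, e n ∈ G) (a l : ι → ℝ)
    (F : Finset ι) :
    ∫ ω, Complex.exp (Complex.I *
        (∑ n ∈ F, (1 / 2 * a n * (e n ω : ℂ) ^ 2 + l n * e n ω))) ∂P =
      (∏ n ∈ F, (1 + -(1 * Complex.I) * a n) ^ (2⁻¹ : ℂ))⁻¹ *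
        Complex.exp (-(1 / 2) * ∑ n ∈ F, (l n : ℂ) ^ 2 / (1 - Complex.I * a n)) := by
  have hm : ∀ n, AEMeasurable (e n) P := fun n => (Lp.aestronglyMeasurable _).aemeasurable
  have hprod : ∀ ω, Complex.exp (Complex.I *
        (∑ n ∈ F, (1 / 2 * a n * (e n ω : ℂ) ^ 2 + l n * e n ω))) =
      ∏ n : F, Complex.exp (Complex.I * (1 / 2 * a n * (e n ω : ℂ) ^ 2 + l n * e n ω)) := by
    intro ω
    rw [Finset.mul_sum, Complex.exp_sum, ← Finset.prod_coe_sort F]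
  simp only [hprod]
  have hc : ∀ n, Continuous fun x : ℝ =>
      Complex.exp (Complex.I * (1 / 2 * a n * (x : ℂ) ^ 2 + l n * x)) := fun n => by fun_prop
  rw [(hG.iIndepFun he heG F).integral_fun_prod_comp (fun n => hm n)
    (f := fun (n : F) (x : ℝ) =>
      Complex.exp (Complex.I * (1 / 2 * a n * (x : ℂ) ^ 2 + l n * x)))
    (fun n => (hc n).aestronglyMeasurable),
    Finset.prod_coe_sort F fun n => ∫ ω,
      Complex.exp (Complex.I * (1 / 2 * a n * (e n ω : ℂ) ^ 2 + l n * e n ω)) ∂P,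
    Finset.mul_sum, Complex.exp_sum, ← Finset.prod_inv_distrib, ← Finset.prod_mul_distrib]
  refine Finset.prod_congr rfl fun n _ => ?_
  have h1 : ‖e n‖₊ ^ 2 = 1 := by
    have := he.1 n
    rw [← coe_nnnorm] at this
    have h2 : ‖e n‖₊ = 1 := by exact_mod_cast this
    rw [h2, one_pow]
  rw [← integral_cexp_quadratic_gaussianReal, ← h1, ← hG.map_eq (heG n),
    integral_map (hm n) (hc n).aestronglyMeasurable]

end GaussianSpaces

/-! ### Diagonal expansion of a random vector and convergence of the Gaussian products. -/

section Expansion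

universe u

variable {Ω : Type u} [MeasurableSpace Ω] {P : Measure Ω} [IsProbabilityMeasure P]
variable {E : Type*} [NormedAddCommGroup E] [InnerProductSpace ℝ E]

omit [IsProbabilityMeasure P] in
theorem integral_norm_mul_norm_le {F : Type*} [NormedAddCommGroup F] [InnerProductSpace ℝ F]
    (f : Lp E 2 P) (g : Lp F 2 P) :
    Integrable (fun ω => ‖f ω‖ * ‖g ω‖) P ∧ ∫ ω, ‖f ω‖ * ‖g ω‖ ∂P ≤ ‖f‖ * ‖g‖ := by
  have hf := (Lp.memLp f).norm
  have hg := (Lp.memLp g).norm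
  refine ⟨hf.integrable_mul hg, ?_⟩
  have h := real_inner_le_norm (hf.toLp _) (hg.toLp _)
  rw [L2.inner_def] at h
  have hnf : ‖hf.toLp _‖ = ‖f‖ := by
    rw [← sq_eq_sq₀ (norm_nonneg _) (norm_nonneg _), norm_toLp_sq, norm_Lp_sq f]
    simp only [norm_norm]
  have hng : ‖hg.toLp _‖ = ‖g‖ := by
    rw [← sq_eq_sq₀ (norm_nonneg _) (norm_nonneg _), norm_toLp_sq, norm_Lp_sq g]
    simp only [norm_norm]
  rw [hnf, hng] at h
  refine le_trans (le_of_eq (integral_congr_ae ?_)) h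
  filter_upwards [hf.coeFn_toLp, hg.coeFn_toLp] with ω h1 h2
  rw [h1, h2]
  simp [mul_comm]

theorem integral_norm_le_norm (f : Lp E 2 P) : ∫ ω, ‖f ω‖ ∂P ≤ ‖f‖ := by
  have h := (integral_norm_mul_norm_le f (Lp.const 2 P (1 : ℝ))).2
  have h1 : ‖Lp.const 2 P (1 : ℝ)‖ ≤ 1 := by
    simpa using Lp.norm_const_le (p := 2) (μ := P) (c := (1 : ℝ))
  refine le_trans (le_of_eq (integral_congr_ae ?_))
    (h.trans (mul_le_of_le_one_right (norm_nonneg _) h1))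
  filter_upwards [Lp.coeFn_const 2 P (1 : ℝ)] with ω hω
  rw [hω]
  simp

/-- The random vector `ω ↦ X ω • v`. -/
noncomputable def tensor (X : Lp ℝ 2 P) (v : E) : Lp E 2 P :=
  (ContinuousLinearMap.toSpanSingleton ℝ v).compLp X

omit [IsProbabilityMeasure P] in
theorem coeFn_tensor (X : Lp ℝ 2 P) (v : E) : tensor X v =ᵐ[P] fun ω => X ω • v := by
  filter_upwards [(ContinuousLinearMap.toSpanSingleton ℝ v).coeFn_compLp X] with ω hω
  rw [tensor, hω, ContinuousLinearMap.toSpanSingleton_apply]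

omit [IsProbabilityMeasure P] in
theorem inner_tensor_tensor (X Y : Lp ℝ 2 P) (u v : E) :
    ⟪tensor X u, tensor Y v⟫_ℝ = ⟪X, Y⟫_ℝ * ⟪u, v⟫_ℝ := by
  rw [L2.inner_def, L2.inner_def, ← integral_mul_const]
  refine integral_congr_ae ?_
  filter_upwards [coeFn_tensor X u, coeFn_tensor Y v] with ω h1 h2
  rw [h1, h2, real_inner_smul_left, real_inner_smul_right]
  simp
  ring

/-- Tensoring with a unit vector of `L²(P)` as a linear isometry. -/
noncomputable def tensorIsometry (X : Lp ℝ 2 P) (hX : ‖X‖ = 1) : E →ₗᵢ[ℝ] Lp E 2 P where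
  toFun v := tensor X v
  map_add' u v := by
    refine Lp.ext ?_
    filter_upwards [coeFn_tensor X (u + v), coeFn_tensor X u, coeFn_tensor X v,
      Lp.coeFn_add (tensor X u) (tensor X v)] with ω h1 h2 h3 h4
    rw [h1, h4, Pi.add_apply, h2, h3, smul_add]
  map_smul' c v := by
    refine Lp.ext ?_
    filter_upwards [coeFn_tensor X (c • v), coeFn_tensor X v,
      Lp.coeFn_smul c (tensor X v)] with ω h1 h2 h3
    rw [RingHom.id_apply, h1, h3, Pi.smul_apply, h2, smul_comm]
  norm_map' v := by
    change ‖tensor X v‖ = ‖v‖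
    rw [← sq_eq_sq₀ (norm_nonneg _) (norm_nonneg _), ← real_inner_self_eq_norm_sq,
      inner_tensor_tensor, real_inner_self_eq_norm_sq, real_inner_self_eq_norm_sq, hX]
    ring

variable [CompleteSpace E]

/-- The expectation `X ↦ E[X Ψ]` as a continuous linear map. -/
noncomputable def expectMul (Ψ : Lp E 2 P) : Lp ℝ 2 P →L[ℝ] E :=
  ((ContinuousLinearMap.lsmul ℝ ℝ).lpPairing P 2 2).flip Ψ

omit [IsProbabilityMeasure P] in
theorem expectMul_apply (Ψ : Lp E 2 P) (X : Lp ℝ 2 P) :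
    expectMul Ψ X = ∫ ω, X ω • Ψ ω ∂P := by
  rw [expectMul, ContinuousLinearMap.flip_apply, ContinuousLinearMap.lpPairing_eq_integral]
  rfl

omit [IsProbabilityMeasure P] [CompleteSpace E] in
theorem integrable_smul_Lp (Ψ : Lp E 2 P) (X : Lp ℝ 2 P) :
    Integrable (fun ω => X ω • Ψ ω) P :=
  memLp_one_iff_integrable.1 ((Lp.memLp Ψ).smul (Lp.memLp X))

omit [IsProbabilityMeasure P] in
theorem inner_expectMul (Ψ : Lp E 2 P) (X : Lp ℝ 2 P) (f : E) :
    ⟪f, expectMul Ψ X⟫_ℝ = ⟪X, (innerSL ℝ f).compLp Ψ⟫_ℝ := by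
  rw [expectMul_apply, ← integral_inner (integrable_smul_Lp Ψ X), L2.inner_def]
  refine integral_congr_ae ?_
  filter_upwards [(innerSL ℝ f).coeFn_compLp Ψ] with ω hω
  rw [hω, real_inner_smul_right, innerSL_apply_apply]
  simp [mul_comm]

omit [IsProbabilityMeasure P] in
/-- Simultaneous diagonalization of a compact quadratic form `A` and of the covariance of a random
vector `Ψ` whose scalar products lie in a closed subspace `G` of `L²(P)`. -/
theorem exists_diagonal_expansion [SecondCountableTopology E] {G : Submodule ℝ (Lp ℝ 2 P)}
    (hGc : IsClosed (G : Set (Lp ℝ 2 P))) (Ψ : Lp E 2 P)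
    (hΨ : ∀ f : E, (innerSL ℝ f).compLp Ψ ∈ G) {A : E →L[ℝ] E} (hAc : IsCompactOperator A)
    (hA : A.IsSymmetric) :
    ∃ (ι : Type u) (e : ι → Lp ℝ 2 P) (y : ι → E) (a : ι → ℝ),
      Orthonormal ℝ e ∧ (∀ n, e n ∈ G) ∧ (∀ n, y n = ∫ ω, e n ω • Ψ ω ∂P) ∧
      (∀ n, ⟪y n, A (y n)⟫_ℝ = a n) ∧ (∀ m n, m ≠ n → ⟪y m, A (y n)⟫_ℝ = 0) ∧
      (Summable fun n => ‖y n‖ ^ 2) ∧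
      (∀ g, HasSum (fun n => ⟪g, y n⟫_ℝ • y n) (∫ ω, ⟪g, Ψ ω⟫_ℝ • Ψ ω ∂P)) ∧
      HasSum (fun n => tensor (e n) (y n)) Ψ := by
  have : CompleteSpace G := hGc.completeSpace_coe
  -- Working on `G` rather than on `E` is the point: eigenvectors of `C* A C` are random variables,
  -- and their images under `C` diagonalize both `A` and `C C*`.
  set C : G →L[ℝ] E := (expectMul Ψ).comp G.subtypeL with hC
  set K : G →L[ℝ] G := (C.adjoint.comp A).comp C with hK
  have hKc : IsCompactOperator K := (hAc.clm_comp C.adjoint).comp_clm C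
  have hKs : K.IsSymmetric := by
    intro X Y
    change ⟪C.adjoint (A (C X)), Y⟫_ℝ = ⟪X, C.adjoint (A (C Y))⟫_ℝ
    rw [ContinuousLinearMap.adjoint_inner_left, ContinuousLinearMap.adjoint_inner_right]
    exact hA _ _
  obtain ⟨ι, b, a, hb⟩ := exists_hilbertBasis_eigenvectors hKc hKs
  set e : ι → Lp ℝ 2 P := fun n => (b n : Lp ℝ 2 P) with he
  set y : ι → E := fun n => expectMul Ψ (e n) with hy
  have hyA : ∀ m n, ⟪y m, A (y n)⟫_ℝ = a n * ⟪b m, b n⟫_ℝ := by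
    intro m n
    rw [← real_inner_smul_right, ← hb n]
    change _ = ⟪b m, C.adjoint (A (C (b n)))⟫_ℝ
    rw [ContinuousLinearMap.adjoint_inner_right]
    rfl
  have horth : Orthonormal ℝ e := b.orthonormal.comp_linearIsometry G.subtypeₗᵢ
  -- The variable `⟪f, Ψ⟫` lies in `G`, so it is the sum of its basis expansion; its coefficients
  -- are `⟪f, C eₙ⟫`.
  have hexp : ∀ f : E, HasSum (fun n => ⟪f, y n⟫_ℝ • e n) ((innerSL ℝ f).compLp Ψ) := by
    intro f
    have h := (b.hasSum_repr ⟨_, hΨ f⟩).mapL G.subtypeL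
    simp only [map_smul, b.repr_apply_apply, Submodule.subtypeL_apply] at h
    convert h using 3 with n
    exact inner_expectMul Ψ (e n) f
  have hbil : ∀ g : E, HasSum (fun n => ⟪g, y n⟫_ℝ • y n) (∫ ω, ⟪g, Ψ ω⟫_ℝ • Ψ ω ∂P) := by
    intro g
    have h := (hexp g).mapL (expectMul Ψ)
    simp only [map_smul] at h
    convert h using 1
    rw [expectMul_apply]
    refine integral_congr_ae ?_
    filter_upwards [(innerSL ℝ g).coeFn_compLp Ψ] with ω hω
    rw [hω, innerSL_apply_apply]
  have hfam : OrthogonalFamily ℝ (fun _ : ι => E) fun n => tensorIsometry (e n) (horth.1 n) := by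
    intro m n hmn u v
    change ⟪tensor (e m) u, tensor (e n) v⟫_ℝ = 0
    rw [inner_tensor_tensor, horth.2 hmn, zero_mul]
  have hinner : ∀ n u, ⟪tensor (e n) u, Ψ⟫_ℝ = ⟪u, y n⟫_ℝ := by
    intro n u
    rw [hy, inner_expectMul, L2.inner_def, L2.inner_def]
    refine integral_congr_ae ?_
    filter_upwards [coeFn_tensor (e n) u, (innerSL ℝ u).coeFn_compLp Ψ] with ω h1 h2
    rw [h1, h2, real_inner_smul_left, innerSL_apply_apply]
    simp [mul_comm]
  -- Bessel's inequality for `Ψ` and the mutually orthogonal images of `E` under tensoring with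
  -- `eₙ`.
  have hsum : Summable fun n => ‖y n‖ ^ 2 := by
    refine summable_of_sum_le (c := ‖Ψ‖ ^ 2) (fun _ => by positivity) fun F => ?_
    have h1 : ‖∑ n ∈ F, tensor (e n) (y n)‖ ^ 2 = ∑ n ∈ F, ‖y n‖ ^ 2 := hfam.norm_sum y F
    have h2 : ⟪∑ n ∈ F, tensor (e n) (y n), Ψ⟫_ℝ = ∑ n ∈ F, ‖y n‖ ^ 2 := by
      rw [sum_inner]
      simp only [hinner, real_inner_self_eq_norm_sq]
    have h3 := real_inner_le_norm (∑ n ∈ F, tensor (e n) (y n)) Ψ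
    rw [h2, ← h1] at h3
    rw [← h1]
    nlinarith [sq_nonneg (‖∑ n ∈ F, tensor (e n) (y n)‖ - ‖Ψ‖)]
  have hten : Summable fun n => tensor (e n) (y n) :=
    (hfam.summable_iff_norm_sq_summable y).2 hsum
  -- The limit is identified weakly: testing against a fixed `f` reduces to `hexp`, and separability
  -- of `E` gives almost sure equality.
  have hlim : ∑' n, tensor (e n) (y n) = Ψ := by
    rw [← sub_eq_zero]
    refine Lp.ext ?_
    refine EventuallyEq.trans ?_ (Lp.coeFn_zero E 2 P).symm
    refine ae_eq_zero_of_forall_inner (𝕜 := ℝ) fun f => ?_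
    have h1 := hten.hasSum.mapL ((innerSL ℝ f).compLpL 2 P)
    have h2 : ∀ n, (innerSL ℝ f).compLpL 2 P (tensor (e n) (y n)) = ⟪f, y n⟫_ℝ • e n := by
      intro n
      refine Lp.ext ?_
      filter_upwards [(innerSL ℝ f).coeFn_compLpL (tensor (e n) (y n)),
        coeFn_tensor (e n) (y n), Lp.coeFn_smul (⟪f, y n⟫_ℝ) (e n)] with ω h3 h4 h5
      rw [h3, h4, h5, innerSL_apply_apply, real_inner_smul_right, Pi.smul_apply, smul_eq_mul,
        mul_comm]
    simp only [h2] at h1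
    have h3 := h1.unique (hexp f)
    filter_upwards [(innerSL ℝ f).coeFn_compLpL (∑' n, tensor (e n) (y n)),
      (innerSL ℝ f).coeFn_compLp Ψ, Lp.coeFn_sub (∑' n, tensor (e n) (y n)) Ψ] with ω h4 h5 h6
    rw [h3, h5] at h4
    rw [h6, Pi.sub_apply, inner_sub_right]
    simp only [innerSL_apply_apply] at h4
    rw [h4, sub_self, Pi.zero_apply]
  refine ⟨ι, e, y, a, horth, fun n => (b n).2, fun n => expectMul_apply _ _, fun n => ?_,
    fun m n hmn => ?_, hsum, hbil, hlim ▸ hten.hasSum⟩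
  · rw [hyA, real_inner_self_eq_norm_sq, b.orthonormal.1]
    ring
  · rw [hyA, b.orthonormal.2 hmn, mul_zero]

omit [CompleteSpace E] in
theorem integrable_cexp_quadratic (A : E →L[ℝ] E) (l : E) (X : Lp E 2 P) :
    Integrable (fun ω => Complex.exp (Complex.I *
      ((1 / 2 * ⟪X ω, A (X ω)⟫_ℝ + ⟪l, X ω⟫_ℝ : ℝ) : ℂ))) P := by
  refine Integrable.of_bound (C := 1) ?_ (Eventually.of_forall fun ω => ?_)
  · have : Continuous fun u : E => Complex.exp (Complex.I *
        ((1 / 2 * ⟪u, A u⟫_ℝ + ⟪l, u⟫_ℝ : ℝ) : ℂ)) := by fun_prop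
    exact this.comp_aestronglyMeasurable (Lp.aestronglyMeasurable X)
  · rw [Complex.norm_exp_I_mul_ofReal]

omit [CompleteSpace E] in
/-- The characteristic functional of a quadratic form is continuous in `L²(P)`. -/
theorem tendsto_integral_cexp_quadratic (A : E →L[ℝ] E) (l : E) {α : Type*} {𝓕 : Filter α}
    {Φ : α → Lp E 2 P} {Ψ : Lp E 2 P} (h : Tendsto Φ 𝓕 (𝓝 Ψ)) :
    Tendsto (fun i => ∫ ω, Complex.exp (Complex.I *
        ((1 / 2 * ⟪Φ i ω, A (Φ i ω)⟫_ℝ + ⟪l, Φ i ω⟫_ℝ : ℝ) : ℂ)) ∂P) 𝓕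
      (𝓝 (∫ ω, Complex.exp (Complex.I *
        ((1 / 2 * ⟪Ψ ω, A (Ψ ω)⟫_ℝ + ⟪l, Ψ ω⟫_ℝ : ℝ) : ℂ)) ∂P)) := by
  set q : E → ℝ := fun u => 1 / 2 * ⟪u, A u⟫_ℝ + ⟪l, u⟫_ℝ with hq
  have hint : ∀ X : Lp E 2 P, Integrable (fun ω => Complex.exp (Complex.I * (q (X ω) : ℂ))) P :=
    integrable_cexp_quadratic A l
  have hqd : ∀ u v : E, ‖q u - q v‖ ≤
      ‖A‖ * (‖u - v‖ * ‖u‖) + ‖A‖ * (‖u - v‖ * ‖v‖) + ‖l‖ * ‖u - v‖ := by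
    intro u v
    have h1 : q u - q v = 1 / 2 * ⟪u - v, A u⟫_ℝ + 1 / 2 * ⟪v, A (u - v)⟫_ℝ + ⟪l, u - v⟫_ℝ := by
      simp only [hq, map_sub, inner_sub_left, inner_sub_right]
      ring
    have h2 : |⟪u - v, A u⟫_ℝ| ≤ ‖A‖ * (‖u - v‖ * ‖u‖) := by
      refine (abs_real_inner_le_norm _ _).trans ?_
      have := A.le_opNorm u
      calc ‖u - v‖ * ‖A u‖ ≤ ‖u - v‖ * (‖A‖ * ‖u‖) := by gcongr
        _ = _ := by ring
    have h3 : |⟪v, A (u - v)⟫_ℝ| ≤ ‖A‖ * (‖u - v‖ * ‖v‖) := by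
      refine (abs_real_inner_le_norm _ _).trans ?_
      have := A.le_opNorm (u - v)
      calc ‖v‖ * ‖A (u - v)‖ ≤ ‖v‖ * (‖A‖ * ‖u - v‖) := by gcongr
        _ = _ := by ring
    have h4 := abs_real_inner_le_norm l (u - v)
    rw [h1, Real.norm_eq_abs]
    refine (abs_add_three _ _ _).trans ?_
    rw [abs_mul, abs_mul]
    have : |(1 / 2 : ℝ)| = 1 / 2 := by norm_num
    rw [this]
    nlinarith [abs_nonneg ⟪u - v, A u⟫_ℝ, abs_nonneg ⟪v, A (u - v)⟫_ℝ]
  have hbound : ∀ X : Lp E 2 P, ‖∫ ω, Complex.exp (Complex.I * (q (X ω) : ℂ)) ∂P -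
      ∫ ω, Complex.exp (Complex.I * (q (Ψ ω) : ℂ)) ∂P‖ ≤
      ‖A‖ * (‖X - Ψ‖ * ‖X‖) + ‖A‖ * (‖X - Ψ‖ * ‖Ψ‖) + ‖l‖ * ‖X - Ψ‖ := by
    intro X
    obtain ⟨i1, b1⟩ := integral_norm_mul_norm_le (X - Ψ) X
    obtain ⟨i2, b2⟩ := integral_norm_mul_norm_le (X - Ψ) Ψ
    have i3 : Integrable (fun ω => ‖(X - Ψ : Lp E 2 P) ω‖) P :=
      ((Lp.memLp (X - Ψ)).integrable one_le_two).norm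
    have b3 := integral_norm_le_norm (X - Ψ)
    rw [← integral_sub (hint X) (hint Ψ)]
    have i12 : Integrable (fun ω => ‖A‖ * (‖(X - Ψ : Lp E 2 P) ω‖ * ‖X ω‖) +
        ‖A‖ * (‖(X - Ψ : Lp E 2 P) ω‖ * ‖Ψ ω‖)) P := (i1.const_mul ‖A‖).add (i2.const_mul ‖A‖)
    calc _ ≤ ∫ ω, (‖A‖ * (‖(X - Ψ : Lp E 2 P) ω‖ * ‖X ω‖) +
          ‖A‖ * (‖(X - Ψ : Lp E 2 P) ω‖ * ‖Ψ ω‖) + ‖l‖ * ‖(X - Ψ : Lp E 2 P) ω‖) ∂P := by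
          refine norm_integral_le_of_norm_le (i12.add (i3.const_mul ‖l‖)) ?_
          filter_upwards [Lp.coeFn_sub X Ψ] with ω hω
          rw [hω, Pi.sub_apply]
          refine le_trans ?_ (hqd _ _)
          have h1 : Complex.exp (Complex.I * (q (X ω) : ℂ)) -
              Complex.exp (Complex.I * (q (Ψ ω) : ℂ)) = Complex.exp (Complex.I * (q (Ψ ω) : ℂ)) *
              (Complex.exp (Complex.I * (q (X ω) - q (Ψ ω) : ℝ)) - 1) := by
            rw [mul_sub, ← Complex.exp_add, mul_one]
            push_cast
            ring_nf
          rw [h1, norm_mul, Complex.norm_exp_I_mul_ofReal, one_mul]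
          exact Real.norm_exp_I_mul_ofReal_sub_one_le
      _ ≤ _ := by
          rw [integral_add i12 (i3.const_mul ‖l‖), integral_add (i1.const_mul ‖A‖)
            (i2.const_mul ‖A‖), integral_const_mul, integral_const_mul, integral_const_mul]
          gcongr
  rw [tendsto_iff_norm_sub_tendsto_zero]
  refine squeeze_zero (fun _ => norm_nonneg _) (fun i => hbound (Φ i)) ?_
  have h0 : Tendsto (fun i => ‖Φ i - Ψ‖) 𝓕 (𝓝 0) := tendsto_iff_norm_sub_tendsto_zero.1 h
  have h1 := (((h0.mul h.norm).const_mul ‖A‖).add ((h0.mul_const ‖Ψ‖).const_mul ‖A‖)).add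
    (h0.const_mul ‖l‖)
  simpa using h1

omit [CompleteSpace E] in
-- Each partial sum of the expansion has a diagonal phase in finitely many independent normals,
-- hence an explicit expectation; continuity of the functional gives the limit.
theorem tendsto_gaussian_products {G : Submodule ℝ (Lp ℝ 2 P)} (hG : IsGaussianSpace P G)
    {ι : Type*} {e : ι → Lp ℝ 2 P} (he : Orthonormal ℝ e) (heG : ∀ n, e n ∈ G) {y : ι → E}
    {Ψ : Lp E 2 P} (hΨ : HasSum (fun n => tensor (e n) (y n)) Ψ) {A : E →L[ℝ] E} {a : ι → ℝ}
    (hdiag : ∀ n, ⟪y n, A (y n)⟫_ℝ = a n) (hoff : ∀ m n, m ≠ n → ⟪y m, A (y n)⟫_ℝ = 0) (l : E) :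
    Tendsto (fun F : Finset ι => (∏ n ∈ F, (1 + -(1 * Complex.I) * a n) ^ (2⁻¹ : ℂ))⁻¹ *
        Complex.exp (-(1 / 2) * ∑ n ∈ F, ((⟪l, y n⟫_ℝ : ℝ) : ℂ) ^ 2 / (1 - Complex.I * a n)))
      atTop (𝓝 (∫ ω, Complex.exp (Complex.I *
        ((1 / 2 * ⟪Ψ ω, A (Ψ ω)⟫_ℝ + ⟪l, Ψ ω⟫_ℝ : ℝ) : ℂ)) ∂P)) := by
  classical
  have h := tendsto_integral_cexp_quadratic A l (show Tendsto (fun F : Finset ι =>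
    ∑ n ∈ F, tensor (e n) (y n)) atTop (𝓝 Ψ) from hΨ)
  refine h.congr fun F => ?_
  rw [← hG.integral_cexp_quadratic he heG a (fun n => ⟪l, y n⟫_ℝ) F]
  refine integral_congr_ae ?_
  have h1 : ∀ᵐ ω ∂P, ∀ n ∈ F, tensor (e n) (y n) ω = e n ω • y n :=
    (Filter.eventually_all_finset F).2 fun n _ => coeFn_tensor (e n) (y n)
  filter_upwards [h1, Lp.coeFn_finsetSum F fun n => tensor (e n) (y n)] with ω h2 h3
  rw [h3, Finset.sum_apply, Finset.sum_congr rfl h2]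
  congr 2
  have h4 : ⟪∑ n ∈ F, e n ω • y n, A (∑ n ∈ F, e n ω • y n)⟫_ℝ = ∑ n ∈ F, a n * e n ω ^ 2 := by
    rw [map_sum, sum_inner]
    refine Finset.sum_congr rfl fun m hm => ?_
    rw [inner_sum, Finset.sum_eq_single_of_mem m hm]
    · rw [map_smul, real_inner_smul_left, real_inner_smul_right, hdiag]
      ring
    · intro n _ hn
      rw [map_smul, real_inner_smul_left, real_inner_smul_right, hoff m n hn.symm]
      ring
  rw [h4, inner_sum, Finset.mul_sum, ← Finset.sum_add_distrib]
  push_cast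
  refine Finset.sum_congr rfl fun n _ => ?_
  rw [real_inner_smul_right]
  push_cast
  ring

end Expansion

/-! ### From the real expansion to the complex operators. -/

section ComplexExpansion

universe u

variable {Ω : Type u} [MeasurableSpace Ω] {P : Measure Ω} [IsProbabilityMeasure P]
variable {E : Type*} [NormedAddCommGroup E] [InnerProductSpace ℝ E] [InnerProductSpace ℂ E]
  [IsScalarTower ℝ ℂ E] [CompleteSpace E]

omit [IsScalarTower ℝ ℂ E] [CompleteSpace E] in
-- Both real and imaginary parts come from the real inner product, at `v` and at `i v`. This
-- upgrades the real expansion of the covariance to the complex-linear `B`.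
theorem inner_complex_eq (hre : ∀ u v : E, ⟪u, v⟫_ℝ = (⟪u, v⟫_ℂ).re) (u v : E) :
    ⟪u, v⟫_ℂ = (⟪v, u⟫_ℝ : ℂ) - Complex.I * (⟪Complex.I • v, u⟫_ℝ : ℂ) := by
  rw [hre, hre, inner_smul_left, ← inner_conj_symm u v]
  generalize ⟪v, u⟫_ℂ = z
  apply Complex.ext <;> simp

theorem exists_isJointDiagonalization [SecondCountableTopology E]
    (hre : ∀ u v : E, ⟪u, v⟫_ℝ = (⟪u, v⟫_ℂ).re) {G : Submodule ℝ (Lp ℝ 2 P)}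
    (hG : IsGaussianSpace P G) (hGc : IsClosed (G : Set (Lp ℝ 2 P))) {Ψ : Lp E 2 P}
    (hΨ : ∀ f : E, (innerSL ℝ f).compLp Ψ ∈ G) {A B : E →L[ℂ] E} (hAc : IsCompactOperator A)
    (hA : IsSelfAdjoint A) (hB : ∀ g, B g = ∫ ω, ⟪Ψ ω, g⟫_ℂ • Ψ ω ∂P) {V : Submodule ℝ E}
    (hVc : IsClosed (V : Set E)) (hV : ∀ u ∈ V, ∀ v ∈ V, (⟪u, v⟫_ℂ).im = 0)
    (hVA : ∀ u ∈ V, A u ∈ V) (hVΨ : ∀ᵐ ω ∂P, Ψ ω ∈ V) :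
    ∃ (ι : Type u) (y : ι → E) (a : ι → ℝ), IsJointDiagonalization A B y a ∧ (∀ n, y n ∈ V) ∧
      ∀ l ∈ V, ∫ ω, Complex.exp (Complex.I *
          ((1 / 2 * ⟪Ψ ω, A (Ψ ω)⟫_ℝ + ⟪l, Ψ ω⟫_ℝ : ℝ) : ℂ)) ∂P =
        (sqrtDet a 1)⁻¹ * Complex.exp (-(1 / 2) *
          ⟪l, Ring.inverse (1 - Complex.I • (B * A)) (B l)⟫_ℂ) := by
  have hcr : ∀ u ∈ V, ∀ v ∈ V, ⟪u, v⟫_ℂ = (⟪u, v⟫_ℝ : ℂ) := fun u hu v hv => by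
    rw [hre]
    exact Complex.ext rfl (hV u hu v hv)
  have hAs : (A.restrictScalars ℝ : E →L[ℝ] E).IsSymmetric := by
    intro u v
    change ⟪A u, v⟫_ℝ = ⟪u, A v⟫_ℝ
    rw [hre, hre, ← ContinuousLinearMap.adjoint_inner_right, hA.adjoint_eq]
  obtain ⟨ι, e, y, a, he, heG, hy, hdiag, hoff, hsum, hbil, hten⟩ :=
    exists_diagonal_expansion hGc Ψ hΨ (A := A.restrictScalars ℝ) hAc hAs
  have hyV : ∀ n, y n ∈ V := by
    intro n
    rw [hy]
    -- An expectation of vectors of a closed convex set stays in it.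
    refine V.convex.integral_mem hVc ?_ (integrable_smul_Lp Ψ (e n))
    filter_upwards [hVΨ] with ω hω
    exact V.smul_mem _ hω
  have hcoe : ∀ (r : ℝ) (v : E), (r : ℂ) • v = r • v := fun r v => algebraMap_smul ℂ r v
  have hinn : ∀ g : E, Integrable (fun ω => ⟪g, Ψ ω⟫_ℝ • Ψ ω) P := by
    intro g
    refine (integrable_smul_Lp Ψ ((innerSL ℝ g).compLp Ψ)).congr ?_
    filter_upwards [(innerSL ℝ g).coeFn_compLp Ψ] with ω hω
    rw [hω, innerSL_apply_apply]
  have hD : IsJointDiagonalization A B y a := by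
    refine ⟨hA, hsum, fun f => ?_, fun n => ?_, fun m n hmn => ?_⟩
    · have h := (hbil f).sub ((hbil (Complex.I • f)).const_smul Complex.I)
      convert h using 1
      · funext n
        rw [inner_complex_eq hre, sub_smul, mul_smul, hcoe, hcoe]
      · have hsm : Integrable (fun ω => Complex.I • ⟪Complex.I • f, Ψ ω⟫_ℝ • Ψ ω) P :=
          (hinn _).smul Complex.I
        rw [hB, ← integral_smul, ← integral_sub (hinn _) hsm]
        refine integral_congr_ae (Eventually.of_forall fun ω => ?_)
        simp only
        rw [inner_complex_eq hre, sub_smul, mul_smul, hcoe, hcoe]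
    · rw [hcr _ (hyV n) _ (hVA _ (hyV n)), ← hdiag]
      rfl
    · rw [hcr _ (hyV m) _ (hVA _ (hyV n)), ← Complex.ofReal_zero, ← hoff m n hmn]
      rfl
  refine ⟨ι, y, a, hD, hyV, fun l hl => ?_⟩
  have h1 := tendsto_gaussian_products hG he heG hten hdiag hoff l
  -- The finite products tend to the expectation; it remains to see that they also tend to the
  -- closed expression.
  refine tendsto_nhds_unique h1 ?_
  have hne : sqrtDet a 1 ≠ 0 := by
    intro h0
    have := sqrtDet_sq hD.summable_eigenvalues 1
    rw [h0] at this
    exact tprod_ne_zero hD.summable_eigenvalues (z := 1) (by simp) (by simpa using this.symm)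
  have h2 : HasSum (fun n => ((⟪l, y n⟫_ℝ : ℝ) : ℂ) ^ 2 / (1 - Complex.I * a n))
      ⟪l, Ring.inverse (1 - Complex.I • (B * A)) (B l)⟫_ℂ := by
    have h := (hD.hasSum_inverse l).mapL (innerSL ℂ l)
    simp only [map_smul, innerSL_apply_apply, smul_eq_mul] at h
    refine h.congr_fun fun n => ?_
    rw [hcr _ hl _ (hyV n), hcr _ (hyV n) _ hl, real_inner_comm l]
    ring
  have h3 := (hasProd_sqrtDet hD.summable_eigenvalues 1)
  exact (Tendsto.inv₀ h3 hne).mul ((Complex.continuous_exp.tendsto _).comp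
    (Tendsto.const_mul (-(1 / 2 : ℂ)) h2))

end ComplexExpansion

/-! ### Sample paths as a random vector in `L²(ℝ)`. -/

section Paths

/-- By second countability every open set is a countable union of balls. -/
theorem measurable_of_measurable_dist {α X : Type*} [MeasurableSpace α] [PseudoMetricSpace X]
    [SecondCountableTopology X] [MeasurableSpace X] [BorelSpace X] {f : α → X}
    (h : ∀ c, Measurable fun ω => dist (f ω) c) : Measurable f := by
  refine measurable_of_isOpen fun U hU => ?_
  choose! r hr using fun x (hx : x ∈ U) => Metric.isOpen_iff.1 hU x hx
  obtain ⟨T, hT, hTU⟩ := TopologicalSpace.isOpen_iUnion_countable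
    (fun x : U => Metric.ball (x : X) (r x)) fun _ => Metric.isOpen_ball
  have hU' : U = ⋃ x ∈ T, Metric.ball (x : X) (r x) := by
    rw [hTU]
    refine Set.Subset.antisymm (fun x hx => Set.mem_iUnion.2 ⟨⟨x, hx⟩, ?_⟩)
      (Set.iUnion_subset fun x => (hr x x.2).2)
    exact Metric.mem_ball_self (hr x hx).1
  rw [hU', Set.preimage_iUnion₂]
  exact MeasurableSet.biUnion hT fun x _ => measurableSet_lt (h x) measurable_const

instance : SecondCountableTopology L2R :=
  have : Fact ((2 : ℝ≥0∞) ≠ ∞) := ⟨ENNReal.ofNat_ne_top⟩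
  Lp.SecondCountableTopology

theorem L2R.inner_real_eq (u v : L2R) : ⟪u, v⟫_ℝ = (⟪u, v⟫_ℂ).re := by
  rw [L2.inner_def, L2.inner_def, ← RCLike.re_eq_complex_re, ← integral_re (L2.integrable_inner u v)]
  rfl

variable {Ω : Type*} [MeasurableSpace Ω] {P : Measure Ω} [IsProbabilityMeasure P]
variable {φ : ℝ → Ω → ℂ}

omit [IsProbabilityMeasure P] in
-- Measurability into `L²(ℝ)` reduces to that of the distance to a fixed function, which is a
-- parameter integral. Paths outside `L²` form a null set and are sent to `0`.
theorem exists_path_map (hφm : Measurable fun p : ℝ × Ω => φ p.1 p.2)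
    (hφ : ∫⁻ ω, (∫⁻ x : ℝ, ‖φ x ω‖ₑ ^ 2) ∂P < ∞) :
    ∃ Ψ : Lp L2R 2 P, ∀ᵐ ω ∂P, Ψ ω =ᵐ[volume] fun x => φ x ω := by
  classical
  have hφω : ∀ ω, Measurable fun x => φ x ω := fun ω => hφm.comp measurable_prodMk_right
  set N : Ω → ℝ≥0∞ := fun ω => ∫⁻ x : ℝ, ‖φ x ω‖ₑ ^ 2 with hN
  have hNm : Measurable N :=
    (hφm.enorm.pow_const 2).lintegral_prod_left
  have hmem : ∀ ω, MemLp (fun x => φ x ω) 2 (volume : Measure ℝ) ↔ N ω < ∞ := by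
    intro ω
    rw [MemLp, and_iff_right (hφω ω).aestronglyMeasurable,
      eLpNorm_lt_top_iff_lintegral_rpow_enorm_lt_top two_ne_zero ENNReal.ofNat_ne_top]
    simp [hN]
  set Φ : Ω → L2R := fun ω => if h : MemLp (fun x => φ x ω) 2 (volume : Measure ℝ)
    then h.toLp _ else 0 with hΦ
  have hS : MeasurableSet {ω | N ω < ∞} := measurableSet_lt hNm measurable_const
  have hΦm : StronglyMeasurable Φ := by
    borelize L2R
    refine Measurable.stronglyMeasurable (measurable_of_measurable_dist fun c => ?_)
    have hd : (fun ω => dist (Φ ω) c) = fun ω => if N ω < ∞ then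
        √(∫ x, ‖φ x ω - c x‖ ^ 2) else ‖c‖ := by
      funext ω
      simp only [hΦ]
      split_ifs with h1 h2 h2
      · rw [dist_eq_norm, ← Real.sqrt_sq (norm_nonneg (_ - c)), norm_Lp_sq]
        congr 1
        refine integral_congr_ae ?_
        filter_upwards [h1.coeFn_toLp, Lp.coeFn_sub (h1.toLp _) c] with x h3 h4
        rw [h4, Pi.sub_apply, h3]
      · exact absurd ((hmem ω).1 h1) h2
      · exact absurd ((hmem ω).2 h2) h1
      · rw [dist_zero_left]
    rw [hd]
    refine Measurable.ite hS (Measurable.sqrt ?_) measurable_const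
    have : StronglyMeasurable fun p : Ω × ℝ => ‖φ p.2 p.1 - c p.2‖ ^ 2 := by
      refine StronglyMeasurable.pow (StronglyMeasurable.norm (StronglyMeasurable.sub ?_ ?_)) 2
      · exact (hφm.comp measurable_swap).stronglyMeasurable
      · exact (Lp.stronglyMeasurable c).comp_measurable measurable_snd
    exact this.integral_prod_right.measurable
  have hfin : ∀ᵐ ω ∂P, N ω < ∞ := ae_lt_top hNm hφ.ne
  have hΦ2 : MemLp Φ 2 P := by
    refine ⟨hΦm.aestronglyMeasurable, ?_⟩
    rw [eLpNorm_lt_top_iff_lintegral_rpow_enorm_lt_top two_ne_zero ENNReal.ofNat_ne_top]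
    refine lt_of_le_of_lt (lintegral_mono_ae ?_) hφ
    filter_upwards [hfin] with ω hω
    simp only [hΦ]
    rw [dif_pos ((hmem ω).2 hω), Lp.enorm_toLp, eLpNorm_eq_lintegral_rpow_enorm_toReal two_ne_zero
      ENNReal.ofNat_ne_top]
    simp [← ENNReal.rpow_mul_natCast]
  refine ⟨hΦ2.toLp Φ, ?_⟩
  filter_upwards [hΦ2.coeFn_toLp, hfin] with ω h1 h2
  rw [h1]
  simp only [hΦ]
  rw [dif_pos ((hmem ω).2 h2)]
  exact MemLp.coeFn_toLp _

variable {Ψ : Lp L2R 2 P}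

omit [IsProbabilityMeasure P] in
theorem ae_inner_path (hΨ : ∀ᵐ ω ∂P, Ψ ω =ᵐ[volume] fun x => φ x ω) (f : L2R) :
    ∀ᵐ ω ∂P, ⟪f, Ψ ω⟫_ℂ = ∫ x, starRingEnd ℂ (f x) * φ x ω ∧
      (Integrable fun x => starRingEnd ℂ (f x) * φ x ω) ∧
      ∫ x, ‖starRingEnd ℂ (f x) * φ x ω‖ ≤ ‖f‖ * ‖Ψ ω‖ := by
  filter_upwards [hΨ] with ω hω
  have h1 : (fun x => ⟪f x, Ψ ω x⟫_ℂ) =ᵐ[volume] fun x => starRingEnd ℂ (f x) * φ x ω := by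
    filter_upwards [hω] with x hx
    rw [hx, RCLike.inner_apply, mul_comm]
  refine ⟨?_, (L2.integrable_inner f (Ψ ω)).congr h1, ?_⟩
  · rw [L2.inner_def]
    exact integral_congr_ae h1
  · refine le_trans (le_of_eq (integral_congr_ae ?_)) (integral_norm_mul_norm_le f (Ψ ω)).2
    filter_upwards [hω] with x hx
    rw [hx, norm_mul, RCLike.norm_conj]

omit [IsProbabilityMeasure P] in
theorem ae_inner_path' (hΨ : ∀ᵐ ω ∂P, Ψ ω =ᵐ[volume] fun x => φ x ω) (f : L2R) :
    ∀ᵐ ω ∂P, ⟪Ψ ω, f⟫_ℂ = ∫ x, starRingEnd ℂ (φ x ω) * f x ∧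
      (Integrable fun x => starRingEnd ℂ (φ x ω) * f x) ∧
      ∫ x, ‖starRingEnd ℂ (φ x ω) * f x‖ ≤ ‖f‖ * ‖Ψ ω‖ := by
  filter_upwards [ae_inner_path hΨ f] with ω ⟨h1, h2, h3⟩
  have h4 : ∀ x, starRingEnd ℂ (φ x ω) * f x = starRingEnd ℂ (starRingEnd ℂ (f x) * φ x ω) := by
    intro x
    rw [map_mul, Complex.conj_conj, mul_comm]
  simp only [h4, RCLike.norm_conj, integral_conj]
  refine ⟨?_, ?_, h3⟩
  · rw [← h1, inner_conj_symm]
  · exact (Complex.conjLIE.integrable_comp_iff).2 h2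

/-- The integral operator of a covariance kernel is the weak covariance operator of the paths. -/
theorem IsIntegralOperator.apply_eq_integral (hφm : Measurable fun p : ℝ × Ω => φ p.1 p.2)
    (hΨ : ∀ᵐ ω ∂P, Ψ ω =ᵐ[volume] fun x => φ x ω) {K : ℝ → ℝ → ℂ}
    (hKm : Measurable fun p : ℝ × ℝ => K p.1 p.2)
    (hK : Integrable fun p : ℝ × ℝ => ‖K p.1 p.2‖ ^ 2) {T : L2R →L[ℂ] L2R}
    (hT : IsIntegralOperator K T)
    (hKφ : ∀ x y, K x y = ∫ ω, φ x ω * starRingEnd ℂ (φ y ω) ∂P) (g : L2R) :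
    T g = ∫ ω, ⟪Ψ ω, g⟫_ℂ • Ψ ω ∂P := by
  refine ext_inner_left ℂ fun f => ?_
  have hint : Integrable (fun ω => ⟪Ψ ω, g⟫_ℂ • Ψ ω) P :=
    memLp_one_iff_integrable.1
      ((Lp.memLp Ψ).smul (φ := fun ω => ⟪Ψ ω, g⟫_ℂ) ((Lp.memLp Ψ).inner_const g))
  rw [← integral_inner hint, hT.inner_eq hKm hK]
  set F : Ω → ℝ × ℝ → ℂ := fun ω p =>
    (starRingEnd ℂ (f p.1) * φ p.1 ω) * (starRingEnd ℂ (φ p.2 ω) * g p.2) with hF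
  have hFm : AEStronglyMeasurable (Function.uncurry F) (P.prod (volume : Measure (ℝ × ℝ))) := by
    refine (StronglyMeasurable.mul (StronglyMeasurable.mul ?_ ?_)
      (StronglyMeasurable.mul ?_ ?_)).aestronglyMeasurable
    · exact Complex.continuous_conj.comp_stronglyMeasurable
        ((Lp.stronglyMeasurable f).comp_measurable (measurable_fst.comp measurable_snd))
    · exact (hφm.comp ((measurable_fst.comp measurable_snd).prodMk
        measurable_fst)).stronglyMeasurable
    · exact Complex.continuous_conj.comp_stronglyMeasurable
        (hφm.comp ((measurable_snd.comp measurable_snd).prodMk measurable_fst)).stronglyMeasurable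
    · exact (Lp.stronglyMeasurable g).comp_measurable (measurable_snd.comp measurable_snd)
  -- Fubini is justified by Cauchy–Schwarz on each path: the inner integral of the norm is at most
  -- `‖f‖ ‖g‖ ‖Ψ ω‖²`.
  have hFi : Integrable (Function.uncurry F) (P.prod (volume : Measure (ℝ × ℝ))) := by
    refine (integrable_prod_iff hFm).2 ⟨?_, ?_⟩
    · filter_upwards [ae_inner_path hΨ f, ae_inner_path' hΨ g] with ω h1 h2
      exact h1.2.1.mul_prod h2.2.1
    · refine (((Lp.memLp Ψ).integrable_norm_pow two_ne_zero).const_mul (‖f‖ * ‖g‖)).mono'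
        hFm.norm.integral_prod_right' ?_
      filter_upwards [ae_inner_path hΨ f, ae_inner_path' hΨ g] with ω h1 h2
      rw [Real.norm_of_nonneg (integral_nonneg fun _ => norm_nonneg _)]
      simp only [Function.uncurry_apply_pair, hF]
      simp only [norm_mul (starRingEnd ℂ (f _) * φ _ ω)]
      rw [Measure.volume_eq_prod, integral_prod_mul
        (fun x => ‖starRingEnd ℂ (f x) * φ x ω‖) (fun y => ‖starRingEnd ℂ (φ y ω) * g y‖)]
      calc _ ≤ (‖f‖ * ‖Ψ ω‖) * (‖g‖ * ‖Ψ ω‖) :=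
            mul_le_mul h1.2.2 h2.2.2 (integral_nonneg fun _ => norm_nonneg _) (by positivity)
        _ = _ := by ring
  have h1 : ∫ ω, ⟪f, ⟪Ψ ω, g⟫_ℂ • Ψ ω⟫_ℂ ∂P = ∫ ω, (∫ p, F ω p) ∂P := by
    refine integral_congr_ae ?_
    filter_upwards [ae_inner_path hΨ f, ae_inner_path' hΨ g] with ω h1 h2
    rw [inner_smul_right, h1.1, h2.1, mul_comm]
    exact (integral_prod_mul (fun x => starRingEnd ℂ (f x) * φ x ω)
      (fun y => starRingEnd ℂ (φ y ω) * g y)).symm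
  rw [h1, integral_integral_swap hFi]
  refine integral_congr_ae (Eventually.of_forall fun p => ?_)
  simp only [hKφ, hF]
  rw [← integral_const_mul, ← integral_mul_const]
  refine integral_congr_ae (Eventually.of_forall fun ω => ?_)
  simp only
  ring

/-- A random variable orthogonal to almost all `φ x` is orthogonal to the scalar products of the
paths. -/
theorem inner_compLp_eq_zero (hφm : Measurable fun p : ℝ × Ω => φ p.1 p.2)
    (hΨ : ∀ᵐ ω ∂P, Ψ ω =ᵐ[volume] fun x => φ x ω) (X : Lp ℝ 2 P)
    (hX : ∀ᵐ x : ℝ, ∫ ω, (X ω : ℂ) * φ x ω ∂P = 0) (f : L2R) :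
    ⟪X, (innerSL ℝ f).compLp Ψ⟫_ℝ = 0 := by
  set F : Ω → ℝ → ℂ := fun ω x => (X ω : ℂ) * (starRingEnd ℂ (f x) * φ x ω) with hF
  have hFm : AEStronglyMeasurable (Function.uncurry F) (P.prod (volume : Measure ℝ)) := by
    refine (StronglyMeasurable.mul ?_ (StronglyMeasurable.mul ?_ ?_)).aestronglyMeasurable
    · exact Complex.continuous_ofReal.comp_stronglyMeasurable
        ((Lp.stronglyMeasurable X).comp_measurable measurable_fst)
    · exact Complex.continuous_conj.comp_stronglyMeasurable
        ((Lp.stronglyMeasurable f).comp_measurable measurable_snd)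
    · exact (hφm.comp measurable_swap).stronglyMeasurable
  have hFi : Integrable (Function.uncurry F) (P.prod (volume : Measure ℝ)) := by
    refine (integrable_prod_iff hFm).2 ⟨?_, ?_⟩
    · filter_upwards [ae_inner_path hΨ f] with ω h1
      exact h1.2.1.const_mul (X ω : ℂ)
    · refine ((integral_norm_mul_norm_le X Ψ).1.const_mul ‖f‖).mono'
        hFm.norm.integral_prod_right' ?_
      filter_upwards [ae_inner_path hΨ f] with ω h1
      rw [Real.norm_of_nonneg (integral_nonneg fun _ => norm_nonneg _)]
      simp only [Function.uncurry_apply_pair, hF]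
      simp only [norm_mul (X ω : ℂ), Complex.norm_real]
      rw [integral_const_mul]
      calc _ ≤ ‖X ω‖ * (‖f‖ * ‖Ψ ω‖) := by gcongr; exact h1.2.2
        _ = _ := by ring
  have h1 : ⟪X, (innerSL ℝ f).compLp Ψ⟫_ℝ = (∫ ω, (∫ x, F ω x) ∂P).re := by
    have h2 := integral_re hFi.integral_prod_left
    rw [← RCLike.re_eq_complex_re]
    refine Eq.trans ?_ h2
    rw [L2.inner_def]
    refine integral_congr_ae ?_
    filter_upwards [(innerSL ℝ f).coeFn_compLp Ψ, ae_inner_path hΨ f] with ω h3 h4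
    rw [h3, innerSL_apply_apply, L2R.inner_real_eq, h4.1]
    simp only [Function.uncurry_apply_pair, hF]
    rw [integral_const_mul, RCLike.re_eq_complex_re, Complex.re_ofReal_mul]
    simp [mul_comm]
  rw [h1, integral_integral_swap hFi]
  have h2 : ∀ᵐ x : ℝ, ∫ ω, F ω x ∂P = 0 := by
    filter_upwards [hX] with x hx
    have : ∀ ω, F ω x = starRingEnd ℂ (f x) * ((X ω : ℂ) * φ x ω) := fun ω => by
      simp only [hF]
      ring
    simp only [this]
    rw [integral_const_mul, hx, mul_zero]
  rw [integral_eq_zero_of_ae h2, Complex.zero_re]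

end Paths

/-! ### The real form of `L²(ℝ)` given by reflection. -/

section ReflectionSymmetry

/-- The `f ∈ L²(ℝ)` with `conj (f x) = f (-x)`. -/
noncomputable def hermitianSubmodule : Submodule ℝ L2R :=
  LinearMap.ker (((Complex.conjCLE : ℂ →L[ℝ] ℂ).compLpL 2 (volume : Measure ℝ) -
    (Lp.compMeasurePreservingₗᵢ ℝ Neg.neg
      (Measure.measurePreserving_neg (volume : Measure ℝ))).toContinuousLinearMap : L2R →L[ℝ] L2R)
    : L2R →ₗ[ℝ] L2R)

theorem isClosed_hermitianSubmodule : IsClosed (hermitianSubmodule : Set L2R) :=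
  ContinuousLinearMap.isClosed_ker _

theorem mem_hermitianSubmodule {f : L2R} :
    f ∈ hermitianSubmodule ↔ ∀ᵐ x : ℝ, starRingEnd ℂ (f x) = f (-x) := by
  have h1 := (Complex.conjCLE : ℂ →L[ℝ] ℂ).coeFn_compLpL (p := 2) (μ := volume) f
  have h2 := Lp.coeFn_compMeasurePreserving f (Measure.measurePreserving_neg (volume : Measure ℝ))
  rw [hermitianSubmodule, LinearMap.mem_ker]
  change _ - Lp.compMeasurePreserving Neg.neg _ f = 0 ↔ _
  rw [sub_eq_zero, Lp.ext_iff]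
  constructor
  · intro h
    filter_upwards [h, h1, h2] with x h3 h4 h5
    exact h4.symm.trans (h3.trans h5)
  · intro h
    filter_upwards [h, h1, h2] with x h3 h4 h5
    exact h4.trans (Eq.trans h3 h5.symm)

theorem ae_comp_neg {p : ℝ → Prop} (h : ∀ᵐ x : ℝ, p x) : ∀ᵐ x : ℝ, p (-x) :=
  (Measure.measurePreserving_neg (volume : Measure ℝ)).quasiMeasurePreserving.ae h

/-- The substitution `x ↦ -x` turns the integral into its complex conjugate. -/
theorem inner_im_eq_zero {u v : L2R} (hu : u ∈ hermitianSubmodule) (hv : v ∈ hermitianSubmodule) :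
    (⟪u, v⟫_ℂ).im = 0 := by
  rw [← Complex.conj_eq_iff_im, L2.inner_def, ← integral_conj, ← integral_neg_eq_self]
  refine integral_congr_ae ?_
  filter_upwards [ae_comp_neg (mem_hermitianSubmodule.1 hu),
    ae_comp_neg (mem_hermitianSubmodule.1 hv)] with x h1 h2
  rw [neg_neg] at h1 h2
  rw [RCLike.inner_apply, RCLike.inner_apply, map_mul, h2, Complex.conj_conj, ← h1,
    Complex.conj_conj]

theorem IsIntegralOperator.mem_hermitianSubmodule {K : ℝ → ℝ → ℂ} {T : L2R →L[ℂ] L2R}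
    (hT : IsIntegralOperator K T) (hK : ∀ x y, starRingEnd ℂ (K x y) = K (-x) (-y)) {f : L2R}
    (hf : f ∈ hermitianSubmodule) : T f ∈ hermitianSubmodule := by
  rw [GaussianFredholm.mem_hermitianSubmodule] at hf ⊢
  filter_upwards [hT f, ae_comp_neg (hT f)] with x h1 h2
  rw [h1.2, h2.2, ← integral_conj, ← integral_neg_eq_self]
  refine integral_congr_ae ?_
  filter_upwards [ae_comp_neg hf] with y hy
  rw [map_mul, hK, hy, neg_neg]

end ReflectionSymmetry

/-! ### The Gaussian space generated by a complex Gaussian process. -/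

section GaussianSpaces

variable {Ω T : Type*} [MeasurableSpace Ω] {P : Measure Ω} [IsProbabilityMeasure P]

omit [IsProbabilityMeasure P] in
theorem integral_cexp_of_hasGaussianLaw {Y : Ω → ℝ} (hY : HasGaussianLaw Y P) {X : Lp ℝ 2 P}
    (hX : X =ᵐ[P] fun ω => Y ω - ∫ ω', Y ω' ∂P) :
    ∫ ω, Complex.exp (X ω * Complex.I) ∂P = Complex.exp (-((‖X‖ ^ 2 : ℝ) : ℂ) / 2) := by
  have hn : ‖X‖ ^ 2 = Var[Y; P] := by
    rw [norm_Lp_sq, variance_eq_integral hY.aemeasurable]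
    refine integral_congr_ae ?_
    filter_upwards [hX] with ω hω
    rw [hω, Real.norm_eq_abs, sq_abs]
  have h1 : ∫ ω, Complex.exp (Y ω * Complex.I) ∂P =
      Complex.exp ((∫ ω', Y ω' ∂P : ℝ) * Complex.I - (Var[Y; P] : ℝ) / 2) := by
    have h2 := charFun_gaussianReal (μ := P[Y]) (v := Var[Y; P].toNNReal) 1
    rw [← hY.map_eq_gaussianReal, charFun_apply_real, integral_map hY.aemeasurable
      (by fun_prop)] at h2
    simpa [Real.coe_toNNReal _ (variance_nonneg Y P)] using h2
  have h3 : ∫ ω, Complex.exp (X ω * Complex.I) ∂P =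
      ∫ ω, Complex.exp (Y ω * Complex.I) * Complex.exp (-((∫ ω', Y ω' ∂P : ℝ) * Complex.I)) ∂P := by
    refine integral_congr_ae ?_
    filter_upwards [hX] with ω hω
    rw [hω, ← Complex.exp_add]
    push_cast
    ring_nf
  rw [h3, integral_mul_const, h1, ← Complex.exp_add, hn]
  congr 1
  ring

/-- `G` is the closed span of the centred real variables `Re (c Z t)` with `c ∈ ℂ`. Letting `c` vary
treats real and imaginary parts uniformly; the choices `1` and `i` recover the complex orthogonality
relation. -/
theorem exists_gaussianSpace {Z : T → Ω → ℂ} (hZ : IsGaussianProcess Z P) :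
    ∃ G : Submodule ℝ (Lp ℝ 2 P), IsGaussianSpace P G ∧ IsClosed (G : Set (Lp ℝ 2 P)) ∧
      ∀ X : Lp ℝ 2 P, (∀ Y ∈ G, ⟪X, Y⟫_ℝ = 0) →
        ∀ t, ∫ ω, (X ω : ℂ) * (Z t ω - ∫ ω', Z t ω' ∂P) ∂P = 0 := by
  set W : ℂ × T → Ω → ℝ := fun i ω => (i.1 * Z i.2 ω).re with hW
  have hWG : IsGaussianProcess W P :=
    (hZ.comp_right Prod.snd).comp_left
      fun i => Complex.reCLM.comp (ContinuousLinearMap.mul ℝ ℂ i.1)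
  have hWL : ∀ i, MemLp (fun ω => W i ω - ∫ ω', W i ω' ∂P) 2 P := fun i =>
    (hWG.hasGaussianLaw_eval i).memLp_two.sub (memLp_const _)
  set g : ℂ × T → Lp ℝ 2 P := fun i => (hWL i).toLp _ with hg
  refine ⟨(Submodule.span ℝ (Set.range g)).topologicalClosure,
    IsGaussianSpace.topologicalClosure fun X hX => ?_,
    Submodule.isClosed_topologicalClosure _, fun X hX t => ?_⟩
  · obtain ⟨c, rfl⟩ := (Finsupp.mem_span_range_iff_exists_finsupp).1 hX
    have hY := (hWG.smul c).hasGaussianLaw_fun_sum (I := c.support)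
    refine integral_cexp_of_hasGaussianLaw hY ?_
    have h1 : ∀ᵐ ω ∂P, ∀ i ∈ c.support, g i ω = W i ω - ∫ ω', W i ω' ∂P :=
      (Filter.eventually_all_finset _).2 fun i _ => (hWL i).coeFn_toLp
    have hWi : ∀ i, Integrable (fun ω => c i • W i ω) P := fun i =>
      (hWG.hasGaussianLaw_eval i).integrable.smul (c i)
    rw [Finsupp.sum]
    filter_upwards [h1, coeFn_finset_sum_smul c.support c g] with ω h2 h3
    rw [h3, integral_finsetSum _ fun i _ => hWi i,
      ← Finset.sum_sub_distrib]
    refine Finset.sum_congr rfl fun i hi => ?_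
    rw [h2 i hi, integral_smul]
    simp only [smul_eq_mul]
    ring
  · have hZi : ∀ c : ℂ, Integrable (fun ω => c * Z t ω) P := fun c =>
      (hZ.hasGaussianLaw_eval t).integrable.const_mul c
    have hint : Integrable (fun ω => (X ω : ℂ) * (Z t ω - ∫ ω', Z t ω' ∂P)) P := by
      have h1 : MemLp (fun ω => Z t ω - ∫ ω', Z t ω' ∂P) 2 P :=
        (hZ.hasGaussianLaw_eval t).memLp_two.sub (memLp_const _)
      exact (Lp.memLp X).ofReal.integrable_mul h1
    have key : ∀ c : ℂ, (c * ∫ ω, (X ω : ℂ) * (Z t ω - ∫ ω', Z t ω' ∂P) ∂P).re = 0 := by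
      intro c
      rw [← hX _ (Submodule.le_topologicalClosure _ (Submodule.subset_span ⟨(c, t), rfl⟩)),
        L2.inner_def, ← integral_const_mul, ← RCLike.re_eq_complex_re,
        ← integral_re (hint.const_mul c)]
      refine integral_congr_ae ?_
      filter_upwards [(hWL (c, t)).coeFn_toLp] with ω hω
      simp only [hg]
      rw [hω]
      simp only [hW]
      have h2 : ∫ ω', (c * Z t ω').re ∂P = (c * ∫ ω', Z t ω' ∂P).re := by
        rw [← integral_const_mul]
        exact integral_re (hZi c)
      rw [h2, ← Complex.sub_re, ← mul_sub]
      simp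
      ring
    have k1 := key 1
    have k2 := key Complex.I
    apply Complex.ext
    · simpa using k1
    · simpa using k2

end GaussianSpaces

/-! ### Mean, covariance kernel and phase of the process. -/

section MeanAndCovariance

variable {Ω : Type*} [MeasurableSpace Ω] {P : Measure Ω} {ψ : ℝ → Ω → ℂ}

theorem measurable_meanFun [SFinite P] (hmeas : Measurable fun p : ℝ × Ω => ψ p.1 p.2) :
    Measurable (meanFun P ψ) :=
  (hmeas.stronglyMeasurable.integral_prod_right' (ν := P)).measurable

/-- `|E ψ(x)|² ≤ E |ψ(x)|²`, integrated over `x` by Tonelli. -/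
theorem memLp_meanFun [IsProbabilityMeasure P] (hmeas : Measurable fun p : ℝ × Ω => ψ p.1 p.2)
    (hL2 : ∫⁻ ω, (∫⁻ x : ℝ, ‖ψ x ω‖ₑ ^ 2) ∂P < ∞) :
    MemLp (meanFun P ψ) 2 (volume : Measure ℝ) := by
  refine ⟨(measurable_meanFun hmeas).aestronglyMeasurable, ?_⟩
  rw [eLpNorm_lt_top_iff_lintegral_rpow_enorm_lt_top two_ne_zero ENNReal.ofNat_ne_top]
  rw [lintegral_lintegral_swap
    ((hmeas.comp measurable_swap).enorm.pow_const 2).aemeasurable] at hL2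
  refine lt_of_le_of_lt (lintegral_mono fun x => ?_) hL2
  have hx : AEStronglyMeasurable (ψ x) P :=
    (hmeas.comp measurable_prodMk_left).aestronglyMeasurable
  have h1 : ‖meanFun P ψ x‖ₑ ≤ eLpNorm (ψ x) 2 P := by
    refine (enorm_integral_le_lintegral_enorm _).trans ?_
    rw [← eLpNorm_one_eq_lintegral_enorm]
    exact eLpNorm_le_eLpNorm_of_exponent_le one_le_two hx
  calc _ ≤ (eLpNorm (ψ x) 2 P) ^ (2 : ℝ≥0∞).toReal := by gcongr
    _ = _ := by
      rw [eLpNorm_eq_lintegral_rpow_enorm_toReal two_ne_zero ENNReal.ofNat_ne_top,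
        ← ENNReal.rpow_mul]
      simp

theorem conj_meanFun {x : ℝ} (h : ∀ᵐ ω ∂P, starRingEnd ℂ (ψ x ω) = ψ (-x) ω) :
    starRingEnd ℂ (meanFun P ψ x) = meanFun P ψ (-x) := by
  rw [meanFun, meanFun, ← integral_conj]
  exact integral_congr_ae h

theorem covKernel_eq (x y : ℝ) : covKernel P ψ x y =
    ∫ ω, (ψ x ω - meanFun P ψ x) * starRingEnd ℂ (ψ y ω - meanFun P ψ y) ∂P := by
  simp only [covKernel, complexCov, meanFun, map_sub, integral_conj]

theorem measurable_covKernel [SFinite P] (hmeas : Measurable fun p : ℝ × Ω => ψ p.1 p.2) :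
    Measurable fun p : ℝ × ℝ => covKernel P ψ p.1 p.2 := by
  simp only [covKernel_eq]
  have hφ : Measurable fun p : ℝ × Ω => ψ p.1 p.2 - meanFun P ψ p.1 :=
    hmeas.sub ((measurable_meanFun hmeas).comp measurable_fst)
  have h1 : StronglyMeasurable fun q : (ℝ × ℝ) × Ω => (ψ q.1.1 q.2 - meanFun P ψ q.1.1) *
      starRingEnd ℂ (ψ q.1.2 q.2 - meanFun P ψ q.1.2) := by
    refine StronglyMeasurable.mul ?_ (Complex.continuous_conj.comp_stronglyMeasurable ?_)
    · exact (hφ.comp (measurable_fst.fst.prodMk measurable_snd)).stronglyMeasurable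
    · exact (hφ.comp (measurable_fst.snd.prodMk measurable_snd)).stronglyMeasurable
  exact (h1.integral_prod_right' (ν := P)).measurable

theorem conj_covKernel (x y : ℝ) : starRingEnd ℂ (covKernel P ψ x y) = covKernel P ψ y x := by
  rw [covKernel_eq, covKernel_eq, ← integral_conj]
  refine integral_congr_ae (Eventually.of_forall fun ω => ?_)
  simp only [map_mul, Complex.conj_conj]
  ring

/-- The exceptional null set of the symmetry depends on `x`; joint measurability allows the two
almost-everywhere quantifiers to be exchanged. -/
theorem ae_mem_hermitianSubmodule [SFinite P] (hmeas : Measurable fun p : ℝ × Ω => ψ p.1 p.2)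
    (hsymm : ∀ x : ℝ, ∀ᵐ ω ∂P, starRingEnd ℂ (ψ x ω) = ψ (-x) ω) {Ψ : Ω → L2R}
    (hΨ : ∀ᵐ ω ∂P, Ψ ω =ᵐ[volume] fun x => ψ x ω) :
    ∀ᵐ ω ∂P, Ψ ω ∈ hermitianSubmodule := by
  have hset : MeasurableSet {p : ℝ × Ω | starRingEnd ℂ (ψ p.1 p.2) = ψ (-p.1) p.2} :=
    measurableSet_eq_fun (Complex.continuous_conj.measurable.comp hmeas)
      (hmeas.comp (measurable_fst.neg.prodMk measurable_snd))
  filter_upwards [(Measure.ae_ae_comm (μ := volume) (ν := P) hset).1 (Eventually.of_forall hsymm), hΨ] with ω h1 h2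
  rw [mem_hermitianSubmodule]
  filter_upwards [h1, h2, ae_comp_neg h2] with x h3 h4 h5
  rw [h4, h5, h3]

theorem phase_eq {A : ℝ → ℝ → ℂ} (hAm : Measurable fun p : ℝ × ℝ => A p.1 p.2)
    (hA : Integrable fun p : ℝ × ℝ => ‖A p.1 p.2‖ ^ 2) {T : L2R →L[ℂ] L2R}
    (hT : IsIntegralOperator A T) (lam u : L2R) {g : ℝ → ℂ} (hg : u =ᵐ[volume] g) :
    (Integrable fun p : ℝ × ℝ => starRingEnd ℂ (g p.1) * A p.1 p.2 * g p.2) ∧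
    (Integrable fun x : ℝ => starRingEnd ℂ (lam x) * g x) ∧
    phase A lam g = 1 / 2 * ⟪u, T u⟫_ℂ + ⟪lam, u⟫_ℂ := by
  have h1 : (fun p : ℝ × ℝ => starRingEnd ℂ (u p.1) * A p.1 p.2 * u p.2) =ᵐ[volume]
      fun p => starRingEnd ℂ (g p.1) * A p.1 p.2 * g p.2 := by
    rw [Measure.volume_eq_prod]
    filter_upwards [Measure.quasiMeasurePreserving_fst.ae hg,
      Measure.quasiMeasurePreserving_snd.ae hg] with p h2 h3
    rw [h2, h3]
  have h2 : (fun x => ⟪lam x, u x⟫_ℂ) =ᵐ[volume] fun x => starRingEnd ℂ (lam x) * g x := by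
    filter_upwards [hg] with x hx
    rw [hx, RCLike.inner_apply, mul_comm]
  refine ⟨(integrable_sesquilinear hAm hA u u).congr h1, (L2.integrable_inner lam u).congr h2, ?_⟩
  rw [phase, hT.inner_eq hAm hA, L2.inner_def, integral_congr_ae h1, integral_congr_ae h2]

/-- As `G` is closed, `G = Gᗮᗮ`. A variable orthogonal to `G` is orthogonal to `φ x` for `x > 0`, by
conjugation for `x < 0`, trivially at `0`, hence to all scalar products of the paths. -/
theorem inner_compLp_mem [IsProbabilityMeasure P] {φ : ℝ → Ω → ℂ}
    (hφm : Measurable fun p : ℝ × Ω => φ p.1 p.2)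
    {Ψ : Lp L2R 2 P} (hΨ : ∀ᵐ ω ∂P, Ψ ω =ᵐ[volume] fun x => φ x ω)
    (hsymm : ∀ x : ℝ, ∀ᵐ ω ∂P, starRingEnd ℂ (φ x ω) = φ (-x) ω) (hzero : ∀ᵐ ω ∂P, φ 0 ω = 0)
    {G : Submodule ℝ (Lp ℝ 2 P)} (hGc : IsClosed (G : Set (Lp ℝ 2 P)))
    (hG : ∀ X : Lp ℝ 2 P, (∀ Y ∈ G, ⟪X, Y⟫_ℝ = 0) →
      ∀ x, 0 < x → ∫ ω, (X ω : ℂ) * φ x ω ∂P = 0) (f : L2R) :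
    (innerSL ℝ f).compLp Ψ ∈ G := by
  have : CompleteSpace G := hGc.completeSpace_coe
  rw [← Submodule.orthogonal_orthogonal G, Submodule.mem_orthogonal]
  intro X hX
  refine inner_compLp_eq_zero hφm hΨ X (Eventually.of_forall fun x => ?_) f
  have hpos := hG X fun Y hY => Submodule.inner_left_of_mem_orthogonal hY hX
  rcases lt_trichotomy x 0 with hx | rfl | hx
  · have h1 := hpos (-x) (neg_pos.2 hx)
    rw [← map_eq_zero (starRingEnd ℂ), ← integral_conj]
    rw [← h1]
    refine integral_congr_ae ?_
    filter_upwards [hsymm x] with ω hω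
    rw [map_mul, Complex.conj_ofReal, hω]
  · refine integral_eq_zero_of_ae ?_
    filter_upwards [hzero] with ω hω
    rw [hω, mul_zero, Pi.zero_apply]
  · exact hpos x hx

end MeanAndCovariance

end GaussianFredholm

theorem mainTheorem6 {Ω : Type*} [MeasurableSpace Ω] (P : Measure Ω) [IsProbabilityMeasure P]
    (ψ : ℝ → Ω → ℂ)
    (hmeas : Measurable (fun p : ℝ × Ω => ψ p.1 p.2))
    (hsymm : ∀ x : ℝ, ∀ᵐ ω ∂P, starRingEnd ℂ (ψ x ω) = ψ (-x) ω)
    (hzero : ∀ᵐ ω ∂P, ψ 0 ω = 0)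
    (hgauss : IsGaussianProcess (fun x : Set.Ioi (0 : ℝ) => ψ x) P)
    (hmom : ∀ k : ℕ, ∃ C b : ℝ, 0 ≤ b ∧ ∀ x : ℝ, ∫ ω, ‖ψ x ω‖ ^ k ∂P ≤ C * (1 + |x| ^ b))
    (hL2 : ∫⁻ ω, (∫⁻ x : ℝ, ‖ψ x ω‖ₑ ^ 2) ∂P < ∞)
    (hB : Integrable (fun p : ℝ × ℝ => ‖GaussianFredholm.covKernel P ψ p.1 p.2‖ ^ 2))
    (A : ℝ → ℝ → ℂ)
    (hAcont : Continuous (fun p : ℝ × ℝ => A p.1 p.2))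
    (hAherm : ∀ x y : ℝ, starRingEnd ℂ (A x y) = A y x)
    (hAsymm : ∀ x y : ℝ, A y x = A (-x) (-y))
    (hAL2 : Integrable (fun p : ℝ × ℝ => ‖A p.1 p.2‖ ^ 2))
    (lam : GaussianFredholm.L2R)
    (hlam : ∀ᵐ x : ℝ, starRingEnd ℂ (lam x) = lam (-x)) :
    -- the paths are almost surely in `L²`, and the integrals in the exponent converge
    (∀ᵐ ω ∂P, MemLp (fun x => ψ x ω) 2 (volume : Measure ℝ) ∧
      Integrable (fun p : ℝ × ℝ => starRingEnd ℂ (ψ p.1 ω) * A p.1 p.2 * ψ p.2 ω) ∧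
      Integrable (fun x : ℝ => starRingEnd ℂ (lam x) * ψ x ω)) ∧
    Integrable (fun ω =>
      Complex.exp (Complex.I * GaussianFredholm.phase A lam (fun x => ψ x ω))) P ∧
    -- the mean is in `L²`, and the kernels define self-adjoint Hilbert–Schmidt operators
    ∃ (hμ : MemLp (GaussianFredholm.meanFun P ψ) 2 (volume : Measure ℝ))
      (opA opB : GaussianFredholm.L2R →L[ℂ] GaussianFredholm.L2R),
      GaussianFredholm.IsIntegralOperator A opA ∧
      GaussianFredholm.IsIntegralOperator (GaussianFredholm.covKernel P ψ) opB ∧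
      IsSelfAdjoint opA ∧ IsSelfAdjoint opB ∧
      GaussianFredholm.IsHilbertSchmidt opA ∧ GaussianFredholm.IsHilbertSchmidt opB ∧
      -- the inverse, the determinant and its square root exist
      GaussianFredholm.IsTraceClass (opB * opA) ∧
      IsUnit (1 - Complex.I • (opB * opA)) ∧
      (∀ z : ℂ, GaussianFredholm.HasFredholmDet (-(z * Complex.I) • (opB * opA))
        (GaussianFredholm.fredholmDet (-(z * Complex.I) • (opB * opA)))) ∧
      (∃ s : ℂ → ℂ, GaussianFredholm.IsSqrtDetermination
        (fun z => GaussianFredholm.fredholmDet (-(z * Complex.I) • (opB * opA))) s) ∧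
      -- the formula
      ∀ s : ℂ → ℂ, GaussianFredholm.IsSqrtDetermination
          (fun z => GaussianFredholm.fredholmDet (-(z * Complex.I) • (opB * opA))) s →
        s 1 ≠ 0 ∧
        ∫ ω, Complex.exp (Complex.I * GaussianFredholm.phase A lam (fun x => ψ x ω)) ∂P =
          Complex.exp
            (1 / 2 * Complex.I * ⟪hμ.toLp (GaussianFredholm.meanFun P ψ),
                opA (Ring.inverse (1 - Complex.I • (opB * opA))
                  (hμ.toLp (GaussianFredholm.meanFun P ψ)))⟫_ℂ
              + Complex.I * ⟪lam, Ring.inverse (1 - Complex.I • (opB * opA))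
                  (hμ.toLp (GaussianFredholm.meanFun P ψ))⟫_ℂ
              - 1 / 2 * ⟪lam, Ring.inverse (1 - Complex.I • (opB * opA)) (opB lam)⟫_ℂ)
            / s 1 := by
  have hAm : Measurable fun p : ℝ × ℝ => A p.1 p.2 := hAcont.measurable
  have hBm := GaussianFredholm.measurable_covKernel (P := P) hmeas
  have hμm := GaussianFredholm.measurable_meanFun (P := P) hmeas
  have hμ := GaussianFredholm.memLp_meanFun (P := P) hmeas hL2
  obtain ⟨opA, hopA⟩ := GaussianFredholm.exists_isIntegralOperator hAm hAL2
  obtain ⟨opB, hopB⟩ := GaussianFredholm.exists_isIntegralOperator hBm hB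
  have hAsa := hopA.isSelfAdjoint hAm hAL2 hAherm
  have hAHS := hopA.isHilbertSchmidt hAm hAL2
  set m : GaussianFredholm.L2R := hμ.toLp (GaussianFredholm.meanFun P ψ) with hm
  -- the paths as a random vector
  obtain ⟨Φ, hΦ⟩ := GaussianFredholm.exists_path_map hmeas hL2
  set φ : ℝ → Ω → ℂ := fun x ω => ψ x ω - GaussianFredholm.meanFun P ψ x with hφ
  have hφm : Measurable fun p : ℝ × Ω => φ p.1 p.2 := hmeas.sub (hμm.comp measurable_fst)
  set Ψ : Lp GaussianFredholm.L2R 2 P := Φ - Lp.const 2 P m with hΨ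
  have hΨΦ : ∀ᵐ ω ∂P, Φ ω = m + Ψ ω := by
    filter_upwards [Lp.coeFn_sub Φ (Lp.const 2 P m), Lp.coeFn_const 2 P m] with ω h1 h2
    rw [h1, Pi.sub_apply, h2, Function.const_apply, add_sub_cancel]
  have hΨφ : ∀ᵐ ω ∂P, Ψ ω =ᵐ[volume] fun x => φ x ω := by
    filter_upwards [hΨΦ, hΦ] with ω h1 h2
    rw [← sub_eq_iff_eq_add'] at h1
    rw [← h1]
    filter_upwards [Lp.coeFn_sub (Φ ω) m, h2, hμ.coeFn_toLp] with x h3 h4 h5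
    rw [h3, Pi.sub_apply, h4, h5]
  have hφsymm : ∀ x : ℝ, ∀ᵐ ω ∂P, starRingEnd ℂ (φ x ω) = φ (-x) ω := by
    intro x
    filter_upwards [hsymm x] with ω hω
    rw [map_sub, hω, GaussianFredholm.conj_meanFun (hsymm x)]
  have hφzero : ∀ᵐ ω ∂P, φ 0 ω = 0 := by
    filter_upwards [hzero] with ω hω
    simp only [hφ, hω, GaussianFredholm.meanFun, integral_eq_zero_of_ae hzero, sub_zero]
  -- the Gaussian space and the joint diagonalization
  obtain ⟨G, hG, hGc, hGX⟩ := GaussianFredholm.exists_gaussianSpace hgauss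
  have hΨG := GaussianFredholm.inner_compLp_mem hφm hΨφ hφsymm hφzero hGc
    fun X hX x hx => hGX X hX ⟨x, hx⟩
  have hVm : m ∈ GaussianFredholm.hermitianSubmodule := by
    rw [GaussianFredholm.mem_hermitianSubmodule]
    filter_upwards [hμ.coeFn_toLp, GaussianFredholm.ae_comp_neg hμ.coeFn_toLp] with x h1 h2
    rw [h1, h2, GaussianFredholm.conj_meanFun (hsymm x)]
  have hVlam : lam ∈ GaussianFredholm.hermitianSubmodule :=
    GaussianFredholm.mem_hermitianSubmodule.2 hlam
  have hVA : ∀ u ∈ GaussianFredholm.hermitianSubmodule,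
      opA u ∈ GaussianFredholm.hermitianSubmodule := fun u hu =>
    hopA.mem_hermitianSubmodule (fun x y => (hAherm x y).trans (hAsymm x y)) hu
  have hVΨ := GaussianFredholm.ae_mem_hermitianSubmodule hφm hφsymm hΨφ
  obtain ⟨ι, y, a, hD, hyV, hform⟩ := GaussianFredholm.exists_isJointDiagonalization
    GaussianFredholm.L2R.inner_real_eq hG hGc hΨG hAHS.isCompactOperator hAsa
    (hopB.apply_eq_integral hφm hΨφ hBm hB GaussianFredholm.covKernel_eq)
    GaussianFredholm.isClosed_hermitianSubmodule
    (fun u hu v hv => GaussianFredholm.inner_im_eq_zero hu hv) hVA hVΨ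
  have hcr : ∀ u ∈ GaussianFredholm.hermitianSubmodule,
      ∀ v ∈ GaussianFredholm.hermitianSubmodule, ⟪u, v⟫_ℂ = (⟪u, v⟫_ℝ : ℂ) := fun u hu v hv => by
    rw [GaussianFredholm.L2R.inner_real_eq]
    exact Complex.ext rfl (GaussianFredholm.inner_im_eq_zero hu hv)
  have hcomm : ∀ u ∈ GaussianFredholm.hermitianSubmodule,
      ∀ v ∈ GaussianFredholm.hermitianSubmodule, ⟪u, v⟫_ℂ = ⟪v, u⟫_ℂ := fun u hu v hv => by
    rw [hcr u hu v hv, hcr v hv u hu, real_inner_comm]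
  -- The linear coefficient of the phase at `m + Ψ`: on the real subspace both cross terms `½ ⟪m, A
  -- Ψ⟫` and `½ ⟪Ψ, A m⟫` equal `½ ⟪A m, Ψ⟫`.
  set l : GaussianFredholm.L2R := lam + opA m with hl
  have hVl : l ∈ GaussianFredholm.hermitianSubmodule := Submodule.add_mem _ hVlam (hVA m hVm)
  -- the phase in terms of the centred paths
  set c : ℂ := 1 / 2 * ⟪m, opA m⟫_ℂ + ⟪lam, m⟫_ℂ with hc
  have hphase : (fun ω => Complex.exp (Complex.I *
      GaussianFredholm.phase A lam (fun x => ψ x ω))) =ᵐ[P] fun ω =>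
      Complex.exp (Complex.I * c) * Complex.exp (Complex.I *
        ((1 / 2 * ⟪Ψ ω, opA.restrictScalars ℝ (Ψ ω)⟫_ℝ + ⟪l, Ψ ω⟫_ℝ : ℝ) : ℂ)) := by
    filter_upwards [hΦ, hΨΦ, hVΨ] with ω h1 h2 h3
    rw [(GaussianFredholm.phase_eq hAm hAL2 hopA lam (Φ ω) h1).2.2, h2, ← Complex.exp_add]
    have h4 : ⟪m, opA (Ψ ω)⟫_ℂ = ⟪opA m, Ψ ω⟫_ℂ := (hD.inner_left m (Ψ ω)).symm
    have h5 : ⟪Ψ ω, opA m⟫_ℂ = ⟪opA m, Ψ ω⟫_ℂ := hcomm _ h3 _ (hVA m hVm)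
    push_cast
    rw [ContinuousLinearMap.coe_restrictScalars', ← hcr _ h3 _ (hVA _ h3), ← hcr _ hVl _ h3]
    simp only [hl, hc, map_add, inner_add_left, inner_add_right, h4, h5]
    ring_nf
  have hexp := (GaussianFredholm.integrable_cexp_quadratic (opA.restrictScalars ℝ) l Ψ).const_mul
    (Complex.exp (Complex.I * c))
  have hdet : ∀ z : ℂ, GaussianFredholm.HasFredholmDet (-(z * Complex.I) • (opB * opA))
      (∏' n, (1 + -(z * Complex.I) * a n)) := fun z => hD.hasFredholmDet _
  have hdet' : (fun z => GaussianFredholm.fredholmDet (-(z * Complex.I) • (opB * opA))) =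
      fun z => ∏' n, (1 + -(z * Complex.I) * a n) := funext fun z => (hdet z).fredholmDet_eq
  have hsqrt := GaussianFredholm.isSqrtDetermination_sqrtDet hD.summable_eigenvalues
  have hne : ∀ z : ℂ, 0 < z.re → ∏' n, (1 + -(z * Complex.I) * a n) ≠ 0 := fun z hz =>
    GaussianFredholm.tprod_ne_zero hD.summable_eigenvalues hz
  refine ⟨?_, hexp.congr hphase.symm, hμ, opA, opB, hopA, hopB, hAsa,
    hopB.isSelfAdjoint hBm hB GaussianFredholm.conj_covKernel, hAHS,
    hopB.isHilbertSchmidt hBm hB, hD.isTraceClass, hD.isUnit, fun z => ?_, ?_, ?_⟩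
  · filter_upwards [hΦ] with ω hω
    obtain ⟨h1, h2, -⟩ := GaussianFredholm.phase_eq hAm hAL2 hopA lam (Φ ω) hω
    exact ⟨(Lp.memLp (Φ ω)).ae_eq hω, h1, h2⟩
  · rw [(hdet z).fredholmDet_eq]
    exact hdet z
  · rw [hdet']
    exact ⟨_, hsqrt⟩
  · rw [hdet']
    intro s hs
    have h1 : (0 : ℝ) < (1 : ℂ).re := by simp
    -- Uniqueness of the determination lets an arbitrary `s` be replaced by the explicit product.
    have hs1 : s 1 = GaussianFredholm.sqrtDet a 1 := hs.eq hne hsqrt h1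
    refine ⟨fun h0 => hne 1 h1 ?_, ?_⟩
    · refine (hs.2.1 1 h1).symm.trans ?_
      rw [h0, zero_pow two_ne_zero]
    · rw [integral_congr_ae hphase, integral_const_mul, ← hm]
      have h2 := hform l hVl
      rw [← hD.exponent_identity lam m (fun n => hcomm _ (hyV n) _ hVlam)
        (fun n => hcomm _ (hyV n) _ (hVA m hVm)), hs1]
      refine (congrArg _ h2).trans ?_
      rw [mul_left_comm, ← Complex.exp_add, mul_comm, ← div_eq_mul_inv, hl, hc]
      ring_nf
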